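/- Let $\mathbb{D}=\{z\in\mathbb{C}:|z|<1\}$ with Lebesgue measure $m$. For $t>-1$ let $\mathrm{d}\lambda_t(z)=\frac{t+1}{\pi}(1-|z|^2)^t\,\mathrm{d}m(z)$ on $\mathbb{D}$, let $L^2_{a,t}(\mathbb{D})$ be the closed subspace of $L^2(\mathbb{D},\lambda_t)$ consisting of holomorphic functions, let $P^{(t)}$ be the orthogonal projection of $L^2(\mathbb{D},\lambda_t)$ onto it, and for a continuous function $f:\overline{\mathbb{D}}\to\mathbb{C}$ let $T^{(t)}_f h=P^{(t)}(fh)$, $h\in L^2_{a,t}(\mathbb{D})$, be the Toeplitz operator with symbol $f$. For $t=-1$ let $T^{(-1)}_f h=P(fh)$ be the Toeplitz operator on the Hardy space $H^2$, that is, on the closure of the analytic polynomials in $L^2$ of the unit circle with normalized arc length measure, where $P$ is the orthogonal projection of this $L^2$ space onto $H^2$. Suppose $t\geq-1$ and let $f,g\in C^2(\overline{\mathbb{D}})$ be complex-valued. Then the commutator $[T^{(t)}_f,T^{(t)}_g]=T^{(t)}_fT^{(t)}_g-T^{(t)}_gT^{(t)}_f$ is a trace class operator, and $$\mathrm{Tr}\,[T^{(t)}_f,T^{(t)}_g]=\frac{1}{2\pi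 i}\int_{\mathbb{D}}\mathrm{d}f\wedge\mathrm{d}g=\frac{1}{2\pi i}\int_{\mathbb{D}}\Big(\frac{\partial f}{\partial x}\frac{\partial g}{\partial y}-\frac{\partial f}{\partial y}\frac{\partial g}{\partial x}\Big)\mathrm{d}m ,$$ where the integrand is integrable on $\mathbb{D}$. In particular the trace does not depend on $t$. -/

import Mathlib

open MeasureTheory Filter Topology
open scoped ENNReal InnerProductSpace

namespace ToeplitzDisk

noncomputable section

/-! ### Trace class operators and the trace -/

/-- A bounded operator `T` on a Hilbert space is trace class if `∑ ⟨|T| eᵢ, eᵢ⟩ < ∞` for every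
orthonormal basis `(eᵢ)`, where `|T| = (T* T)^{1/2}`. -/
def IsTraceClass.{u} {H : Type u} [NormedAddCommGroup H] [InnerProductSpace ℂ H] [CompleteSpace H]
    (T : H →L[ℂ] H) : Prop :=
  ∀ (ι : Type u) (e : HilbertBasis ι ℂ H), Summable fun i => ⟪e i, CFC.abs T (e i)⟫_ℂ

/-- `HasTrace T a`: the operator `T` is trace class and `Tr T = a`, that is,
`∑ ⟨T eᵢ, eᵢ⟩` converges (unconditionally) to `a` for every orthonormal basis `(eᵢ)`.
(Mathlib's inner product is linear in its second argument.) -/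
def HasTrace.{u} {H : Type u} [NormedAddCommGroup H] [InnerProductSpace ℂ H] [CompleteSpace H]
    (T : H →L[ℂ] H) (a : ℂ) : Prop :=
  IsTraceClass T ∧
    ∀ (ι : Type u) (e : HilbertBasis ι ℂ H), HasSum (fun i => ⟪e i, T (e i)⟫_ℂ) a

/-! ### Multiplication operators and their compressions -/

/-- The multiplication operator `M_φ` on `L²(μ)` with symbol `φ ∈ L^∞(μ)`. -/
def mulOp {α : Type*} [MeasurableSpace α] (μ : Measure α) (φ : α → ℂ) (hφ : MemLp φ ∞ μ) :
    Lp ℂ 2 μ →L[ℂ] Lp ℂ 2 μ :=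
  (ContinuousLinearMap.mul ℂ ℂ).holderL μ ∞ 2 2 (hφ.toLp φ)

theorem mulOp_apply_ae {α : Type*} [MeasurableSpace α] (μ : Measure α) (φ : α → ℂ)
    (hφ : MemLp φ ∞ μ) (h : Lp ℂ 2 μ) :
    mulOp μ φ hφ h =ᵐ[μ] fun x => φ x * h x := by
  have h1 := (ContinuousLinearMap.mul ℂ ℂ).coeFn_holder (r := 2) (hφ.toLp φ) h
  have h2 := hφ.coeFn_toLp
  filter_upwards [h1, h2] with x hx1 hx2
  have : mulOp μ φ hφ h x = (ContinuousLinearMap.mul ℂ ℂ) ((hφ.toLp φ) x) (h x) := hx1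
  rw [this, hx2]; rfl

/-- The compression `P M_φ |_K` to a closed subspace `K` of `L²(μ)`, where `P` is the orthogonal
projection of `L²(μ)` onto `K`. -/
def compression {α : Type*} [MeasurableSpace α] (μ : Measure α) (K : Submodule ℂ (Lp ℂ 2 μ))
    [K.HasOrthogonalProjection] (φ : α → ℂ) (hφ : MemLp φ ∞ μ) : K →L[ℂ] K :=
  K.orthogonalProjectionOnto ∘L mulOp μ φ hφ ∘L K.subtypeL

/-! ### Weighted Bergman spaces of the unit disk -/

/-- The measure `dλ_t = (t + 1)/π · (1 - |z|²)^t dm` on the open unit disk (a probability measure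
for `t > -1`). -/
def bergmanMeasure (t : ℝ) : Measure ℂ :=
  (volume.restrict (Metric.ball (0 : ℂ) 1)).withDensity
    fun z => ENNReal.ofReal ((t + 1) / Real.pi * (1 - ‖z‖ ^ 2) ^ t)

/-- The weighted Bergman space: the subspace of `L²(λ_t)` of (classes of) holomorphic functions
on the open unit disk. -/
def bergmanSpace (t : ℝ) : Submodule ℂ (Lp ℂ 2 (bergmanMeasure t)) where
  carrier := {h | ∃ F : ℂ → ℂ, DifferentiableOn ℂ F (Metric.ball 0 1) ∧
    h =ᵐ[bergmanMeasure t] F}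
  add_mem' := by
    rintro a b ⟨F, hF, haF⟩ ⟨G, hG, hbG⟩
    exact ⟨F + G, hF.add hG, (Lp.coeFn_add a b).trans (haF.add hbG)⟩
  zero_mem' := ⟨0, differentiableOn_const 0, Lp.coeFn_zero ..⟩
  smul_mem' := by
    rintro c a ⟨F, hF, haF⟩
    exact ⟨c • F, hF.const_smul c, (Lp.coeFn_smul c a).trans (haF.const_smul c)⟩

/-- Circle form of the mean value inequality for holomorphic functions. -/
theorem circle_mean_value {F : ℂ → ℂ} {z : ℂ} {ρ r : ℝ} (hr : 0 < r) (hrρ : r < ρ)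
    (hF : DifferentiableOn ℂ F (Metric.ball z ρ)) :
    ENNReal.ofReal (2 * Real.pi) * ‖F z‖ₑ ≤
      ∫⁻ θ in Set.Ioo (-Real.pi) Real.pi, ‖F (circleMap z r θ)‖ₑ := by
  have h1 : DiffContOnCl ℂ F (Metric.ball z |r|) := by
    rw [abs_of_pos hr]
    exact (hF.mono (Metric.closedBall_subset_ball hrρ)).diffContOnCl_ball subset_rfl
  have h2 := h1.circleAverage
  rw [Real.circleAverage_eq_integral_add (-Real.pi)] at h2
  have h3 := intervalIntegral.integral_comp_add_right (a := 0) (b := 2 * Real.pi)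
    (fun θ => F (circleMap z r θ)) (-Real.pi)
  rw [h3] at h2
  have e1 : (0 : ℝ) + -Real.pi = -Real.pi := by ring
  have e2 : 2 * Real.pi + -Real.pi = Real.pi := by ring
  rw [e1, e2, intervalIntegral.integral_of_le (by linarith [Real.pi_pos]),
    integral_Ioc_eq_integral_Ioo] at h2
  have h4 : (2 * Real.pi : ℝ) • F z = ∫ θ in Set.Ioo (-Real.pi) Real.pi, F (circleMap z r θ) := by
    rw [← h2, smul_smul, mul_inv_cancel₀ (by positivity), one_smul]
  calc ENNReal.ofReal (2 * Real.pi) * ‖F z‖ₑ = ‖(2 * Real.pi : ℝ) • F z‖ₑ := by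
        rw [enorm_smul, Real.enorm_of_nonneg (by positivity)]
    _ ≤ _ := by rw [h4]; exact enorm_integral_le_lintegral_enorm _

/-- Area form of the mean value inequality for holomorphic functions. -/
theorem sub_mean_value {F : ℂ → ℂ} {z : ℂ} {ρ : ℝ} (hρ : 0 < ρ)
    (hF : DifferentiableOn ℂ F (Metric.ball z ρ)) :
    ‖F z‖ₑ * ENNReal.ofReal (Real.pi * ρ ^ 2) ≤ ∫⁻ w in Metric.ball z ρ, ‖F w‖ₑ := by
  classical
  set G : ℂ → ℝ≥0∞ := (Metric.ball z ρ).indicator fun w => ‖F w‖ₑ with hG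
  have hGm : Measurable G := by
    rw [hG, ← Set.piecewise_eq_indicator]
    exact ContinuousOn.measurable_piecewise hF.continuousOn.enorm continuousOn_const
      Metric.isOpen_ball.measurableSet
  have h1 : ∫⁻ w in Metric.ball z ρ, ‖F w‖ₑ = ∫⁻ w, G (z + w) := by
    rw [lintegral_add_left_eq_self G z, hG, lintegral_indicator Metric.isOpen_ball.measurableSet]
  rw [h1, ← Complex.lintegral_comp_polarCoord_symm (fun w => G (z + w)), polarCoord_target,
    Measure.volume_eq_prod, setLIntegral_prod]
  swap
  · apply Measurable.aemeasurable
    apply Measurable.mul (by fun_prop)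
    have e : (fun p : ℝ × ℝ => Complex.polarCoord.symm p) =
        fun p => (p.1 : ℂ) * (Real.cos p.2 + Real.sin p.2 * Complex.I) :=
      funext fun p => Complex.polarCoord_symm_apply p
    have e' : Measurable fun p : ℝ × ℝ => Complex.polarCoord.symm p := by
      rw [e]; fun_prop
    exact hGm.comp (measurable_const.add e')
  calc ‖F z‖ₑ * ENNReal.ofReal (Real.pi * ρ ^ 2)
      = ∫⁻ r in Set.Ioo 0 ρ, ENNReal.ofReal r * (ENNReal.ofReal (2 * Real.pi) * ‖F z‖ₑ) := by
        rw [lintegral_mul_const _ (by fun_prop)]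
        have : ∫⁻ r in Set.Ioo 0 ρ, ENNReal.ofReal r = ENNReal.ofReal (ρ ^ 2 / 2) := by
          rw [← ofReal_integral_eq_lintegral_ofReal, ← integral_Ioc_eq_integral_Ioo,
            ← intervalIntegral.integral_of_le hρ.le, integral_id]
          · simp
          · exact (continuous_id.integrableOn_Icc (a := 0) (b := ρ)).mono_set Set.Ioo_subset_Icc_self
          · filter_upwards [ae_restrict_mem measurableSet_Ioo] with r hr using hr.1.le
        rw [this, ← mul_assoc, ← ENNReal.ofReal_mul (by positivity), mul_comm]
        congr 2; ring
    _ ≤ ∫⁻ r in Set.Ioo 0 ρ, ∫⁻ θ in Set.Ioo (-Real.pi) Real.pi,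
          ENNReal.ofReal r • G (z + Complex.polarCoord.symm (r, θ)) := by
        apply setLIntegral_mono' measurableSet_Ioo
        intro r hr
        have h5 : ∀ θ, G (z + Complex.polarCoord.symm (r, θ)) = ‖F (circleMap z r θ)‖ₑ := by
          intro θ
          have e : z + Complex.polarCoord.symm (r, θ) = circleMap z r θ := by
            rw [Complex.polarCoord_symm_apply, circleMap, Complex.exp_mul_I]
            simp
          rw [e, hG, Set.indicator_of_mem]
          have e2 := circleMap_mem_sphere z hr.1.le θ
          rw [mem_sphere_iff_norm] at e2
          rw [mem_ball_iff_norm, e2]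
          exact hr.2
        simp only [h5, smul_eq_mul]
        rw [lintegral_const_mul' _ _ ENNReal.ofReal_ne_top]
        gcongr
        exact circle_mean_value hr.1 hr.2 hF
    _ ≤ _ := lintegral_mono_set Set.Ioo_subset_Ioi_self

/-- Point evaluations are bounded on the weighted Bergman space, locally uniformly in the disk. -/
theorem exists_norm_le_of_mem {t r : ℝ} (ht : -1 < t) (hr0 : 0 < r) (hr : r < 1) :
    ∃ C : ℝ, 0 < C ∧ ∀ (h : Lp ℂ 2 (bergmanMeasure t)) (F : ℂ → ℂ),
      DifferentiableOn ℂ F (Metric.ball 0 1) → h =ᵐ[bergmanMeasure t] F →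
      ∀ z ∈ Metric.closedBall (0 : ℂ) r, ‖F z‖ ≤ C * ‖h‖ := by
  set ρ : ℝ := (1 - r) / 2 with hρ
  have hρ0 : 0 < ρ := by rw [hρ]; linarith
  have hρ1 : ρ < 1 := by rw [hρ]; linarith
  set a : ℝ := 1 - (1 - ρ) ^ 2 with ha
  have ha0 : 0 < a := by rw [ha]; nlinarith
  have hpi := Real.pi_pos
  have ht' : 0 < t + 1 := by linarith
  set c : ℝ := (t + 1) / Real.pi * min (a ^ t) 1 with hc
  have hc0 : 0 < c := by
    have := Real.rpow_pos_of_pos ha0 t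
    rw [hc]; positivity
  have hdens : ∀ w ∈ Metric.ball (0 : ℂ) (1 - ρ),
      c ≤ (t + 1) / Real.pi * (1 - ‖w‖ ^ 2) ^ t := by
    intro w hw
    rw [mem_ball_zero_iff] at hw
    have h1 : a ≤ 1 - ‖w‖ ^ 2 := by
      rw [ha]; nlinarith [norm_nonneg w]
    rw [hc]
    gcongr
    rcases le_total 0 t with h | h
    · exact (min_le_left _ _).trans (Real.rpow_le_rpow ha0.le h1 h)
    · exact (min_le_right _ _).trans
        (Real.one_le_rpow_of_pos_of_le_one_of_nonpos (by linarith)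
          (by nlinarith [norm_nonneg w]) h)
  set D : ℝ := c * (Real.pi * ρ ^ 2) with hD
  have hD0 : 0 < D := by positivity
  refine ⟨Real.sqrt D⁻¹, by positivity, fun h F hF hh z hz => ?_⟩
  rw [mem_closedBall_zero_iff] at hz
  have hsub : Metric.ball z ρ ⊆ Metric.ball 0 (1 - ρ) := by
    apply Metric.ball_subset_ball'
    rw [dist_zero_right]; linarith
  have hsub1 : Metric.ball (0 : ℂ) (1 - ρ) ⊆ Metric.ball 0 1 :=
    Metric.ball_subset_ball (by linarith)
  have hF2 : DifferentiableOn ℂ (fun w => F w ^ 2) (Metric.ball z ρ) :=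
    (hF.mono (hsub.trans hsub1)).pow 2
  have h1 := sub_mean_value hρ0 hF2
  have hm : AEMeasurable (fun w => ‖F w ^ 2‖ₑ) (volume.restrict (Metric.ball (0 : ℂ) 1)) :=
    ((hF.continuousOn.pow 2).enorm).aemeasurable Metric.isOpen_ball.measurableSet
  have h2 : ENNReal.ofReal c * ∫⁻ w in Metric.ball z ρ, ‖F w ^ 2‖ₑ ≤
      ∫⁻ w, ‖F w ^ 2‖ₑ ∂(bergmanMeasure t) := by
    rw [bergmanMeasure, lintegral_withDensity_eq_lintegral_mul₀ (by fun_prop) hm,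
      ← lintegral_const_mul' _ _ ENNReal.ofReal_ne_top]
    refine le_trans ?_ (lintegral_mono_set (hsub.trans hsub1))
    apply setLIntegral_mono' Metric.isOpen_ball.measurableSet
    intro w hw
    simp only [Pi.mul_apply]
    gcongr
    exact hdens w (hsub hw)
  have h3 : ∫⁻ w, ‖F w ^ 2‖ₑ ∂(bergmanMeasure t) = ‖h‖ₑ ^ 2 := by
    rw [Lp.enorm_def, eLpNorm_congr_ae hh,
      eLpNorm_eq_lintegral_rpow_enorm_toReal (by norm_num) (by norm_num)]
    simp only [ENNReal.toReal_ofNat, ENNReal.rpow_ofNat, enorm_pow]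
    rw [← ENNReal.rpow_natCast, ← ENNReal.rpow_mul]
    norm_num
  have h4 : ENNReal.ofReal D * ‖F z‖ₑ ^ 2 ≤ ‖h‖ₑ ^ 2 := by
    rw [← h3]
    refine le_trans ?_ h2
    rw [hD, ENNReal.ofReal_mul hc0.le, mul_assoc]
    gcongr
    rw [mul_comm, ← enorm_pow]
    exact h1
  have h5 : D * ‖F z‖ ^ 2 ≤ ‖h‖ ^ 2 := by
    rw [← ofReal_norm, ← ofReal_norm, ← ENNReal.ofReal_pow (norm_nonneg _),
      ← ENNReal.ofReal_pow (norm_nonneg _), ← ENNReal.ofReal_mul hD0.le,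
      ENNReal.ofReal_le_ofReal_iff (by positivity)] at h4
    exact h4
  apply le_of_sq_le_sq _ (by positivity)
  rw [mul_pow, Real.sq_sqrt (by positivity)]
  rw [inv_mul_eq_div, le_div_iff₀ hD0]
  linarith

/-- The weighted Bergman space is closed in `L²(λ_t)`. -/
theorem isClosed_bergmanSpace (t : ℝ) :
    IsClosed (bergmanSpace t : Set (Lp ℂ 2 (bergmanMeasure t))) := by
  rcases le_or_gt t (-1) with ht | ht
  · have h0 : bergmanMeasure t = 0 := by
      rw [bergmanMeasure, withDensity_eq_zero_iff (by fun_prop)]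
      filter_upwards [ae_restrict_mem Metric.isOpen_ball.measurableSet] with z hz
      rw [mem_ball_zero_iff] at hz
      apply ENNReal.ofReal_of_nonpos
      apply mul_nonpos_of_nonpos_of_nonneg
      · exact div_nonpos_of_nonpos_of_nonneg (by linarith) Real.pi_pos.le
      · exact Real.rpow_nonneg (by nlinarith [norm_nonneg z]) _
    have : (bergmanSpace t : Set (Lp ℂ 2 (bergmanMeasure t))) = Set.univ := by
      refine Set.eq_univ_of_forall fun h => ⟨0, differentiableOn_const 0, ?_⟩
      exact Filter.Eventually.filter_mono (ae_eq_bot.2 h0).le Filter.eventually_bot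
    rw [this]; exact isClosed_univ
  rw [← isSeqClosed_iff_isClosed]
  intro h h₀ hmem hlim
  choose F hF hhF using hmem
  have hcau := hlim.cauchySeq
  have huc : ∀ r : ℝ, 0 < r → r < 1 →
      UniformCauchySeqOn F atTop (Metric.closedBall (0 : ℂ) r) := by
    intro r hr0 hr
    obtain ⟨C, hC0, hC⟩ := exists_norm_le_of_mem ht hr0 hr
    rw [Metric.uniformCauchySeqOn_iff]
    intro ε hε
    obtain ⟨N, hN⟩ := Metric.cauchySeq_iff.1 hcau (ε / C) (by positivity)
    refine ⟨N, fun m hm n hn z hz => ?_⟩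
    have h1 := hC (h m - h n) (F m - F n) ((hF m).sub (hF n))
      ((Lp.coeFn_sub _ _).trans ((hhF m).sub (hhF n))) z hz
    have h2 := hN m hm n hn
    rw [dist_eq_norm] at h2 ⊢
    calc ‖F m z - F n z‖ ≤ C * ‖h m - h n‖ := h1
      _ < C * (ε / C) := by gcongr
      _ = ε := by field_simp
  have hpt : ∀ z : ℂ, ∃ y : ℂ, z ∈ Metric.ball (0 : ℂ) 1 →
      Tendsto (fun n => F n z) atTop (𝓝 y) := by
    intro z
    by_cases hz : z ∈ Metric.ball (0 : ℂ) 1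
    · have hz' : ‖z‖ < 1 := mem_ball_zero_iff.1 hz
      have := (huc ((1 + ‖z‖) / 2) (by positivity) (by linarith)).cauchySeq
        (x := z) (mem_closedBall_zero_iff.2 (by linarith))
      obtain ⟨y, hy⟩ := cauchySeq_tendsto_of_complete this
      exact ⟨y, fun _ => hy⟩
    · exact ⟨0, fun h => absurd h hz⟩
  choose G hG using hpt
  have hloc : TendstoLocallyUniformlyOn F G atTop (Metric.ball (0 : ℂ) 1) := by
    rw [tendstoLocallyUniformlyOn_iff_forall_isCompact Metric.isOpen_ball]
    intro K hK hKc
    obtain ⟨r, ⟨hr0, hr1⟩, hKr⟩ := exists_pos_lt_subset_ball one_pos hKc.isClosed hK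
    refine ((huc r hr0 hr1).tendstoUniformlyOn_of_tendsto fun z hz => hG z ?_).mono
      (hKr.trans Metric.ball_subset_closedBall)
    exact Metric.closedBall_subset_ball hr1 hz
  refine ⟨G, hloc.differentiableOn (Eventually.of_forall hF) Metric.isOpen_ball, ?_⟩
  obtain ⟨ns, hns, hae⟩ :=
    (tendstoInMeasure_of_tendsto_Lp hlim).exists_seq_tendsto_ae
  have hball : ∀ᵐ z ∂(bergmanMeasure t), z ∈ Metric.ball (0 : ℂ) 1 :=
    (withDensity_absolutelyContinuous _ _).ae_le
      (ae_restrict_mem Metric.isOpen_ball.measurableSet)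
  filter_upwards [hae, hball, ae_all_iff.2 hhF] with z h1 h2 h3
  refine tendsto_nhds_unique h1 ?_
  simp only [h3]
  exact (hG z h2).comp hns.tendsto_atTop

instance (t : ℝ) : CompleteSpace (bergmanSpace t) :=
  (isClosed_bergmanSpace t).completeSpace_coe

theorem memLp_bergmanMeasure (t : ℝ) {f : ℂ → ℂ}
    (hf : ContinuousOn f (Metric.closedBall 0 1)) : MemLp f ∞ (bergmanMeasure t) := by
  obtain ⟨C, hC⟩ := (isCompact_closedBall (0 : ℂ) 1).exists_bound_of_continuousOn hf
  have hac : bergmanMeasure t ≪ volume.restrict (Metric.ball (0 : ℂ) 1) :=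
    withDensity_absolutelyContinuous _ _
  refine memLp_top_of_bound (C := C) ?_ ?_
  · exact ((hf.mono Metric.ball_subset_closedBall).aestronglyMeasurable
      Metric.isOpen_ball.measurableSet).mono_ac hac
  · filter_upwards [hac.ae_le (ae_restrict_mem Metric.isOpen_ball.measurableSet)] with z hz
    exact hC z (Metric.ball_subset_closedBall hz)

/-- The Toeplitz operator `T_f = P M_f` on the weighted Bergman space, for a symbol `f` that is
continuous on the closed unit disk. -/
def bergmanToeplitz (t : ℝ) (f : ℂ → ℂ) (hf : ContinuousOn f (Metric.closedBall 0 1)) :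
    bergmanSpace t →L[ℂ] bergmanSpace t :=
  compression (bergmanMeasure t) (bergmanSpace t) f (memLp_bergmanMeasure t hf)

/-! ### The Hardy space of the unit circle

The unit circle with its normalized arc length measure is parametrized by `θ ∈ ℝ/ℤ`,
`θ ↦ e^{2πiθ}`, so that `fourier n θ` is the value of `zⁿ` at the corresponding point. -/

/-- The Hardy space `H²`: the closure in `L²` of the unit circle of the analytic polynomials, i.e.
of the linear span of the monomials `zⁿ`, `n = 0, 1, 2, …`. -/
def hardySpace : Submodule ℂ (Lp ℂ 2 (AddCircle.haarAddCircle (T := (1 : ℝ)))) :=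
  (Submodule.span ℂ (Set.range fun n : ℕ => fourierLp 2 (n : ℤ))).topologicalClosure

instance : CompleteSpace hardySpace := by
  unfold hardySpace; infer_instance

theorem memLp_haarAddCircle {f : ℂ → ℂ} (hf : ContinuousOn f (Metric.sphere 0 1)) :
    MemLp (fun θ : AddCircle (1 : ℝ) => f (AddCircle.toCircle θ : ℂ)) ∞
      AddCircle.haarAddCircle := by
  have hc : Continuous fun θ : AddCircle (1 : ℝ) => f (AddCircle.toCircle θ : ℂ) :=
    hf.comp_continuous (continuous_subtype_val.comp AddCircle.continuous_toCircle)
      fun θ => (AddCircle.toCircle θ).2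
  obtain ⟨C, hC⟩ := isCompact_univ.exists_bound_of_continuousOn hc.continuousOn
  exact memLp_top_of_bound hc.aestronglyMeasurable C
    (Eventually.of_forall fun θ => hC θ (Set.mem_univ θ))

/-- The Toeplitz operator `T_f = P M_f` on the Hardy space, for a symbol `f` that is continuous on
the unit circle. -/
def hardyToeplitz (f : ℂ → ℂ) (hf : ContinuousOn f (Metric.sphere 0 1)) :
    hardySpace →L[ℂ] hardySpace :=
  compression AddCircle.haarAddCircle hardySpace
    (fun θ : AddCircle (1 : ℝ) => f (AddCircle.toCircle θ : ℂ)) (memLp_haarAddCircle hf)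

/-! ### The two-form `df ∧ dg` -/

/-- The coefficient of `df ∧ dg` with respect to `dx ∧ dy`, i.e. the value of this alternating
form on the frame `(∂/∂x, ∂/∂y) = (1, i)`: `∂f/∂x ∂g/∂y - ∂f/∂y ∂g/∂x`. -/
def wedgeCoeff (f g : ℂ → ℂ) (z : ℂ) : ℂ :=
  fderiv ℝ f z 1 * fderiv ℝ g z Complex.I - fderiv ℝ f z Complex.I * fderiv ℝ g z 1

end

end ToeplitzDisk

/-!
# The trace formula for commutators of Toeplitz operators on the disk

Both the Hardy space and the weighted Bergman spaces are closed subspaces `K` of some `L²(μ)` with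
an orthogonal basis formed by the powers `u n` of a coordinate function `φ` with values in the
closed unit disk, and in both cases `‖u (n + 1)‖² / ‖u n‖² → 1`. Nothing else about them is needed
(`IsDiskModel`), which is why the trace does not depend on the weight.

Write `H_f = (1 - P) M_f` for the Hankel operator. Then `[T_f, T_g] = H_ḡ† H_f - H_f̄† H_g`
(`inner_commutator`), so it suffices for the trace class property that Hankel operators with
Lipschitz symbols are Hilbert–Schmidt. If `P_N` is the projection onto the span of the first `N`
basis vectors `e_n` and `K_N` is its kernel, then
`∑_{n < N} ‖(1 - P_N) M_f e_n‖² = ½ ∬ |f(x) - f(y)|² |K_N(x, y)|²` (`kernel_identity`). Hence a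
symbol with Lipschitz constant `L` is dominated by `L` times the coordinate. For the coordinate only
the last term of the sum is nonzero, and it is at most `1`, so `‖H_f‖_HS ≤ L`
(`hsNormSq_hankel_le`).

Consequently both sides of the trace formula are bilinear forms bounded by the product of the
Lipschitz constants of `f` and `g` (`exists_hasTrace`, `norm_wedgeIntegral_le`). Polynomials in `z`
and `conj z` approximate `C²` functions on the closed disk in the Lipschitz seminorm
(`exists_poly_approx`), so it is enough to compare the two sides on monomials. There the diagonal of
the commutator is a telescoping sum, whose limit is computed from the ratios of the norms
(`trace_monom`), and the integral of `df ∧ dg` is elementary (`wedgeIntegral_monom`).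

The trace is independent of the basis because, by polarization, the trace of `A† B` is a combination
of Hilbert–Schmidt norms, which are independent of the basis.
-/

namespace ToeplitzDisk

noncomputable section

/-! ### Hilbert–Schmidt operators and the trace class -/

section HilbertSchmidt

theorem tsum_enorm_inner_sq {H ι : Type*} [NormedAddCommGroup H] [InnerProductSpace ℂ H]
    (e : HilbertBasis ι ℂ H) (x : H) : ∑' i, ‖⟪e i, x⟫_ℂ‖ₑ ^ 2 = ‖x‖ₑ ^ 2 := by
  have h1 : HasSum (fun i => ‖⟪e i, x⟫_ℂ‖ ^ 2) (‖x‖ ^ 2) := by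
    have h2 := Complex.hasSum_re (e.hasSum_inner_mul_inner x x)
    convert h2 using 1
    · ext i
      rw [← inner_conj_symm x (e i), RCLike.conj_mul]
      norm_cast
    · rw [inner_self_eq_norm_sq_to_K]
      norm_cast
  simp only [← ofReal_norm, ← ENNReal.ofReal_pow (norm_nonneg _)]
  rw [← ENNReal.ofReal_tsum_of_nonneg (fun i => by positivity) h1.summable, h1.tsum_eq]

variable {H K L : Type*} [NormedAddCommGroup H] [InnerProductSpace ℂ H] [CompleteSpace H]
  [NormedAddCommGroup K] [InnerProductSpace ℂ K] [CompleteSpace K]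
  [NormedAddCommGroup L] [InnerProductSpace ℂ L] [CompleteSpace L]

theorem tsum_enorm_adjoint {ι κ : Type*} (e : HilbertBasis ι ℂ H) (f : HilbertBasis κ ℂ K)
    (A : H →L[ℂ] K) :
    ∑' i, ‖A (e i)‖ₑ ^ 2 = ∑' j, ‖A.adjoint (f j)‖ₑ ^ 2 := by
  calc ∑' i, ‖A (e i)‖ₑ ^ 2 = ∑' i, ∑' j, ‖⟪f j, A (e i)⟫_ℂ‖ₑ ^ 2 := by
        simp only [tsum_enorm_inner_sq]
    _ = ∑' j, ∑' i, ‖⟪f j, A (e i)⟫_ℂ‖ₑ ^ 2 := ENNReal.tsum_comm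
    _ = _ := by
        refine tsum_congr fun j => ?_
        rw [← tsum_enorm_inner_sq e]
        refine tsum_congr fun i => ?_
        rw [ContinuousLinearMap.adjoint_inner_right, ← inner_conj_symm,
          RCLike.enorm_conj]

/-- The square of the Hilbert–Schmidt norm of `A`, computed in some orthonormal basis; it does not
depend on the basis by `tsum_enorm_sq_eq`. -/
def hsNormSq (A : H →L[ℂ] K) : ℝ≥0∞ :=
  ∑' i : (exists_hilbertBasis ℂ H).choose, ‖A (i : H)‖ₑ ^ 2

theorem tsum_enorm_sq_eq {ι : Type*} (e : HilbertBasis ι ℂ H) (A : H →L[ℂ] K) :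
    ∑' i, ‖A (e i)‖ₑ ^ 2 = hsNormSq A := by
  obtain ⟨b, hb⟩ := (exists_hilbertBasis ℂ H).choose_spec
  obtain ⟨w, f, -⟩ := exists_hilbertBasis ℂ K
  have h := tsum_enorm_adjoint b f A
  rw [hb] at h
  rw [hsNormSq, h, tsum_enorm_adjoint e f]

theorem hsNormSq_adjoint (A : H →L[ℂ] K) :
    hsNormSq (A.adjoint) = hsNormSq A := by
  obtain ⟨w, f, -⟩ := exists_hilbertBasis ℂ K
  obtain ⟨v, e, -⟩ := exists_hilbertBasis ℂ H
  rw [← tsum_enorm_sq_eq f, ← tsum_enorm_sq_eq e, tsum_enorm_adjoint e f]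

theorem hsNormSq_comp_left_ne_top {H K L : Type*} [NormedAddCommGroup H] [InnerProductSpace ℂ H]
    [CompleteSpace H] [NormedAddCommGroup K] [InnerProductSpace ℂ K] [NormedAddCommGroup L]
    [InnerProductSpace ℂ L] {A : H →L[ℂ] K} (B : K →L[ℂ] L) (hA : hsNormSq A ≠ ∞) :
    hsNormSq (B ∘L A) ≠ ∞ := by
  refine ne_top_of_le_ne_top (ENNReal.mul_ne_top (enorm_ne_top (x := ‖B‖ ^ 2)) hA) ?_
  rw [hsNormSq, hsNormSq, ← ENNReal.tsum_mul_left]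
  refine ENNReal.tsum_le_tsum fun i => ?_
  rw [enorm_pow, ← mul_pow, enorm_norm]
  gcongr
  exact B.le_opENorm _

theorem hsNormSq_comp_right_ne_top {A : K →L[ℂ] L} (B : H →L[ℂ] K) (hA : hsNormSq A ≠ ∞) :
    hsNormSq (A ∘L B) ≠ ∞ := by
  rw [← hsNormSq_adjoint, ContinuousLinearMap.adjoint_comp]
  exact hsNormSq_comp_left_ne_top _ (by rwa [hsNormSq_adjoint])

theorem hsNormSq_add_ne_top {H K : Type*} [NormedAddCommGroup H] [InnerProductSpace ℂ H]
    [CompleteSpace H] [NormedAddCommGroup K] [InnerProductSpace ℂ K]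
    {A B : H →L[ℂ] K} (hA : hsNormSq A ≠ ∞) (hB : hsNormSq B ≠ ∞) :
    hsNormSq (A + B) ≠ ∞ := by
  refine ne_top_of_le_ne_top (ENNReal.mul_ne_top (ENNReal.ofNat_ne_top (n := 2))
    (ENNReal.add_ne_top.2 ⟨hA, hB⟩)) ?_
  rw [hsNormSq, hsNormSq, hsNormSq, ← ENNReal.tsum_add, ← ENNReal.tsum_mul_left]
  refine ENNReal.tsum_le_tsum fun i => ?_
  refine (pow_le_pow_left' (enorm_add_le (A i) (B i)) 2).trans ?_
  simpa [ENNReal.rpow_ofNat, show (2 : ℝ) - 1 = 1 by norm_num] using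
    ENNReal.rpow_add_le_mul_rpow_add_rpow ‖A i‖ₑ ‖B i‖ₑ (p := 2) (by norm_num)

theorem hsNormSq_smul_ne_top {H K : Type*} [NormedAddCommGroup H] [InnerProductSpace ℂ H]
    [CompleteSpace H] [NormedAddCommGroup K] [InnerProductSpace ℂ K]
    {A : H →L[ℂ] K} (c : ℂ) (hA : hsNormSq A ≠ ∞) :
    hsNormSq (c • A) ≠ ∞ := by
  have := hsNormSq_comp_left_ne_top (c • ContinuousLinearMap.id ℂ K) hA
  rwa [ContinuousLinearMap.smul_comp, ContinuousLinearMap.id_comp] at this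

theorem hsNormSq_sub_ne_top {H K : Type*} [NormedAddCommGroup H] [InnerProductSpace ℂ H]
    [CompleteSpace H] [NormedAddCommGroup K] [InnerProductSpace ℂ K]
    {A B : H →L[ℂ] K} (hA : hsNormSq A ≠ ∞) (hB : hsNormSq B ≠ ∞) :
    hsNormSq (A - B) ≠ ∞ := by
  have := hsNormSq_add_ne_top hA (hsNormSq_smul_ne_top (-1) hB)
  rwa [neg_one_smul, ← sub_eq_add_neg] at this

theorem hasSum_norm_sq {ι : Type*} (e : HilbertBasis ι ℂ H) {A : H →L[ℂ] K}
    (hA : hsNormSq A ≠ ∞) : HasSum (fun i => ‖A (e i)‖ ^ 2) (hsNormSq A).toReal := by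
  rw [← tsum_enorm_sq_eq e A] at hA ⊢
  have h := ENNReal.hasSum_toReal hA
  rw [← ENNReal.tsum_toReal_eq (fun i => by finiteness)] at h
  simpa using h

/-- The trace `Tr (A† B)` for Hilbert–Schmidt operators `A` and `B`, defined by polarization of the
Hilbert–Schmidt norm. -/
def hsInner (A B : H →L[ℂ] K) : ℂ :=
  (((hsNormSq (A + B)).toReal : ℂ) - (hsNormSq (A - B)).toReal +
    ((hsNormSq (A - Complex.I • B)).toReal - (hsNormSq (A + Complex.I • B)).toReal) *
      Complex.I) / 4

/-- Since `hsInner` is defined without reference to a basis, this gives the independence of the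
trace from the basis. -/
theorem hasSum_inner {ι : Type*} (e : HilbertBasis ι ℂ H) {A B : H →L[ℂ] K}
    (hA : hsNormSq A ≠ ∞) (hB : hsNormSq B ≠ ∞) :
    HasSum (fun i => ⟪A (e i), B (e i)⟫_ℂ) (hsInner A B) := by
  have hI := hsNormSq_smul_ne_top Complex.I hB
  have h1 := Complex.hasSum_ofReal.2 (hasSum_norm_sq e (hsNormSq_add_ne_top hA hB))
  have h2 := Complex.hasSum_ofReal.2 (hasSum_norm_sq e (hsNormSq_sub_ne_top hA hB))
  have h3 := Complex.hasSum_ofReal.2 (hasSum_norm_sq e (hsNormSq_add_ne_top hA hI))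
  have h4 := Complex.hasSum_ofReal.2 (hasSum_norm_sq e (hsNormSq_sub_ne_top hA hI))
  have h5 := ((h1.sub h2).add ((h4.sub h3).mul_right Complex.I)).div_const 4
  convert! h5 using 1
  ext i
  rw [inner_eq_sum_norm_sq_div_four]
  simp

/-- Polar decomposition in the form `|T| = V† T` with `V` bounded. -/
theorem exists_abs_eq_adjoint_comp (T : H →L[ℂ] H) :
    ∃ V : H →L[ℂ] H, CFC.abs T = V.adjoint ∘L T := by
  set S := CFC.abs T with hS
  have hSa : ∀ x y, ⟪S x, y⟫_ℂ = ⟪x, S y⟫_ℂ := by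
    have h : IsSelfAdjoint S := (CFC.abs_nonneg T).isSelfAdjoint
    exact fun x y => (ContinuousLinearMap.isSelfAdjoint_iff_isSymmetric.1 h) x y
  have hST : ∀ x y, ⟪S x, S y⟫_ℂ = ⟪T x, T y⟫_ℂ := by
    intro x y
    have h := congr($(CFC.abs_mul_abs T) y)
    rw [hSa, ← ContinuousLinearMap.adjoint_inner_right T]
    exact congrArg _ h
  have hnorm : ∀ x, ‖T x‖ = ‖S x‖ := by
    intro x
    have h := hST x x
    rw [inner_self_eq_norm_sq_to_K, inner_self_eq_norm_sq_to_K] at h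
    norm_cast at h
    exact ((sq_eq_sq₀ (norm_nonneg _) (norm_nonneg _)).1 h).symm
  set R : Submodule ℂ H := (LinearMap.range (S : H →ₗ[ℂ] H)).topologicalClosure with hR
  have hmem : ∀ x, S x ∈ R := fun x => Submodule.le_topologicalClosure _ ⟨x, rfl⟩
  let S' : H →ₗ[ℂ] R := (S : H →ₗ[ℂ] H).codRestrict R hmem
  have hdense : DenseRange S' := by
    intro y
    rw [closure_subtype]
    refine closure_mono ?_ y.2
    rintro _ ⟨x, rfl⟩
    exact ⟨S' x, ⟨x, rfl⟩, rfl⟩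
  have hbound : ∃ C, ∀ x, ‖(T : H →ₗ[ℂ] H) x‖ ≤ C * ‖S' x‖ :=
    ⟨1, fun x => by rw [one_mul]; exact (hnorm x).le⟩
  have : CompleteSpace R := (Submodule.isClosed_topologicalClosure _).completeSpace_coe
  let V₁ : R →L[ℂ] H := (T : H →ₗ[ℂ] H).extendOfNorm S'
  have hV₁ : ∀ x, V₁ (S' x) = T x := LinearMap.extendOfNorm_eq hdense hbound
  refine ⟨V₁ ∘L R.orthogonalProjectionOnto, ?_⟩
  rw [ContinuousLinearMap.adjoint_comp, ContinuousLinearMap.comp_assoc]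
  -- Both sides take values in `R`, and they agree when paired with the dense subspace `ran |T|`.
  have key : ∀ x, S' x = V₁.adjoint (T x) := by
    intro x
    have h : (fun y : R => ⟪y, S' x⟫_ℂ) = fun y : R => ⟪y, V₁.adjoint (T x)⟫_ℂ := by
      refine hdense.equalizer (by fun_prop) (by fun_prop) (funext fun y => ?_)
      simp only [Function.comp_apply]
      rw [ContinuousLinearMap.adjoint_inner_right, hV₁, ← hST]
      rfl
    exact ext_inner_left ℂ fun v => congrFun h v
  ext x
  simp only [ContinuousLinearMap.comp_apply]
  rw [← key, Submodule.adjoint_orthogonalProjectionOnto]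
  rfl

/-- Cauchy–Schwarz for the Hilbert–Schmidt inner product. -/
theorem norm_hsInner_le {A B : H →L[ℂ] K} {a b : ℝ} (ha : 0 ≤ a) (hb : 0 ≤ b)
    (hA : hsNormSq A ≤ ENNReal.ofReal (a ^ 2)) (hB : hsNormSq B ≤ ENNReal.ofReal (b ^ 2)) :
    ‖hsInner A B‖ ≤ a * b := by
  obtain ⟨v, e, -⟩ := exists_hilbertBasis ℂ H
  have hA' := ne_top_of_le_ne_top ENNReal.ofReal_ne_top hA
  have hB' := ne_top_of_le_ne_top ENNReal.ofReal_ne_top hB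
  have bound : ∀ {C : H →L[ℂ] K} {c : ℝ}, 0 ≤ c → hsNormSq C ≤ ENNReal.ofReal (c ^ 2) →
      ∀ s : Finset v, √(∑ i ∈ s, ‖C (e i)‖ ^ 2) ≤ c := by
    intro C c hc hC s
    rw [Real.sqrt_le_left hc]
    refine (sum_le_hasSum s (fun i _ => by positivity)
      (hasSum_norm_sq e (ne_top_of_le_ne_top ENNReal.ofReal_ne_top hC))).trans ?_
    exact ENNReal.toReal_le_of_le_ofReal (by positivity) hC
  refine le_of_tendsto (hasSum_inner e hA' hB').norm (Eventually.of_forall fun s => ?_)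
  calc ‖∑ i ∈ s, ⟪A (e i), B (e i)⟫_ℂ‖ ≤ ∑ i ∈ s, ‖A (e i)‖ * ‖B (e i)‖ :=
        norm_sum_le_of_le s fun i _ => norm_inner_le_norm _ _
    _ ≤ √(∑ i ∈ s, ‖A (e i)‖ ^ 2) * √(∑ i ∈ s, ‖B (e i)‖ ^ 2) :=
        Real.sum_mul_le_sqrt_mul_sqrt _ _ _
    _ ≤ a * b := by
        gcongr
        exacts [bound ha hA s, bound hb hB s]

theorem hasTrace_of_hilbertSchmidt.{u} {H : Type u} [NormedAddCommGroup H] [InnerProductSpace ℂ H]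
    [CompleteSpace H] {T : H →L[ℂ] H} {A B C D : H →L[ℂ] K} (hA : hsNormSq A ≠ ∞)
    (hB : hsNormSq B ≠ ∞) (hC : hsNormSq C ≠ ∞) (hD : hsNormSq D ≠ ∞)
    (hT : T = A.adjoint ∘L B - C.adjoint ∘L D) :
    HasTrace T (hsInner A B - hsInner C D) := by
  constructor
  · intro ι e
    obtain ⟨V, hV⟩ := exists_abs_eq_adjoint_comp T
    have h1 := hasSum_inner e (hsNormSq_comp_right_ne_top V hA) hB
    have h2 := hasSum_inner e (hsNormSq_comp_right_ne_top V hC) hD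
    refine (h1.sub h2).summable.congr fun i => ?_
    rw [hV, hT]
    simp [ContinuousLinearMap.adjoint_inner_right]
  · intro ι e
    convert! (hasSum_inner e hA hB).sub (hasSum_inner e hC hD) using 1
    ext i
    rw [hT]
    simp [ContinuousLinearMap.adjoint_inner_right]

end HilbertSchmidt
/-! ### Multiplication, Toeplitz and Hankel operators -/

section Compression

open scoped ComplexConjugate

variable {α : Type*} [MeasurableSpace α] {μ : Measure α}

theorem memLp_conj {φ : α → ℂ} (hφ : MemLp φ ∞ μ) : MemLp (fun x => conj (φ x)) ∞ μ := hφ.star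

theorem mulOp_add {φ ψ : α → ℂ} (hφ : MemLp φ ∞ μ) (hψ : MemLp ψ ∞ μ)
    (h : MemLp (fun x => φ x + ψ x) ∞ μ) : mulOp μ _ h = mulOp μ φ hφ + mulOp μ ψ hψ := by
  rw [mulOp, mulOp, mulOp, ← map_add]
  congr 1

theorem mulOp_sub {φ ψ : α → ℂ} (hφ : MemLp φ ∞ μ) (hψ : MemLp ψ ∞ μ)
    (h : MemLp (fun x => φ x - ψ x) ∞ μ) : mulOp μ _ h = mulOp μ φ hφ - mulOp μ ψ hψ := by
  rw [mulOp, mulOp, mulOp, ← map_sub]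
  congr 1

theorem mulOp_smul {φ : α → ℂ} (c : ℂ) (hφ : MemLp φ ∞ μ) (h : MemLp (fun x => c * φ x) ∞ μ) :
    mulOp μ _ h = c • mulOp μ φ hφ := by
  rw [mulOp, mulOp, ← map_smul]
  congr 1

theorem mulOp_comm {φ ψ : α → ℂ} (hφ : MemLp φ ∞ μ) (hψ : MemLp ψ ∞ μ) (h : Lp ℂ 2 μ) :
    mulOp μ φ hφ (mulOp μ ψ hψ h) = mulOp μ ψ hψ (mulOp μ φ hφ h) := by
  apply Lp.ext
  filter_upwards [mulOp_apply_ae μ φ hφ h, mulOp_apply_ae μ ψ hψ h,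
    mulOp_apply_ae μ φ hφ (mulOp μ ψ hψ h), mulOp_apply_ae μ ψ hψ (mulOp μ φ hφ h)]
    with x h1 h2 h3 h4
  rw [h3, h4, h1, h2]
  ring

theorem inner_mulOp_conj {φ : α → ℂ} (hφ : MemLp φ ∞ μ) (g h : Lp ℂ 2 μ) :
    ⟪mulOp μ _ (memLp_conj hφ) g, h⟫_ℂ = ⟪g, mulOp μ φ hφ h⟫_ℂ := by
  rw [L2.inner_def, L2.inner_def]
  refine integral_congr_ae ?_
  filter_upwards [mulOp_apply_ae μ φ hφ h, mulOp_apply_ae μ _ (memLp_conj hφ) g] with x h1 h2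
  rw [h1, h2]
  simp only [RCLike.inner_apply, map_mul, RingHomCompTriple.comp_apply, RingHom.id_apply]
  ring

variable {K : Submodule ℂ (Lp ℂ 2 μ)} [K.HasOrthogonalProjection]

/-- The Hankel operator `(1 - P) M_φ` from `K` to the orthogonal complement of `K` in `L²(μ)`,
considered as an operator into `L²(μ)`. -/
def hankel (K : Submodule ℂ (Lp ℂ 2 μ)) [K.HasOrthogonalProjection] (φ : α → ℂ)
    (hφ : MemLp φ ∞ μ) : K →L[ℂ] Lp ℂ 2 μ :=
  mulOp μ φ hφ ∘L K.subtypeL - K.subtypeL ∘L compression μ K φ hφ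

theorem hankel_apply {φ : α → ℂ} (hφ : MemLp φ ∞ μ) (x : K) :
    hankel K φ hφ x = mulOp μ φ hφ x - K.orthogonalProjectionOnto (mulOp μ φ hφ x) := rfl

theorem inner_compression {φ : α → ℂ} (hφ : MemLp φ ∞ μ) (x y : K) :
    ⟪x, compression μ K φ hφ y⟫_ℂ = ⟪(x : Lp ℂ 2 μ), mulOp μ φ hφ y⟫_ℂ :=
  Submodule.inner_orthogonalProjectionOnto_eq_of_mem_left x _

theorem inner_hankel {φ : α → ℂ} (hφ : MemLp φ ∞ μ) (x y : K) :
    ⟪(x : Lp ℂ 2 μ), hankel K φ hφ y⟫_ℂ = 0 := by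
  have h := inner_compression hφ x y
  rw [hankel_apply, inner_sub_right, ← h]
  exact sub_eq_zero.2 rfl

theorem compression_comp_compression {φ ψ : α → ℂ} (hφ : MemLp φ ∞ μ) (hψ : MemLp ψ ∞ μ)
    (x y : K) : ⟪x, compression μ K φ hφ (compression μ K ψ hψ y)⟫_ℂ =
      ⟪(x : Lp ℂ 2 μ), mulOp μ φ hφ (mulOp μ ψ hψ y)⟫_ℂ -
        ⟪hankel K _ (memLp_conj hφ) x, hankel K ψ hψ y⟫_ℂ := by
  have h1 : ((compression μ K ψ hψ y : K) : Lp ℂ 2 μ) = mulOp μ ψ hψ y - hankel K ψ hψ y := by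
    rw [hankel_apply, sub_sub_cancel]; rfl
  have h2 : ⟪hankel K _ (memLp_conj hφ) x, hankel K ψ hψ y⟫_ℂ =
      ⟪(x : Lp ℂ 2 μ), mulOp μ φ hφ (hankel K ψ hψ y)⟫_ℂ := by
    conv_lhs => rw [hankel_apply]
    rw [inner_sub_left, inner_hankel, sub_zero, inner_mulOp_conj]
  rw [inner_compression, h1, map_sub, inner_sub_right, h2]

/-- The commutator of two Toeplitz operators in terms of Hankel operators:
`[T_φ, T_ψ] = H_ψ̄† H_φ - H_φ̄† H_ψ`. -/
theorem inner_commutator {φ ψ : α → ℂ} (hφ : MemLp φ ∞ μ) (hψ : MemLp ψ ∞ μ) (x y : K) :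
    ⟪x, ⁅compression μ K φ hφ, compression μ K ψ hψ⁆ y⟫_ℂ =
      ⟪hankel K _ (memLp_conj hψ) x, hankel K φ hφ y⟫_ℂ -
        ⟪hankel K _ (memLp_conj hφ) x, hankel K ψ hψ y⟫_ℂ := by
  rw [Ring.lie_def, sub_apply, mul_apply_eq_comp,
    mul_apply_eq_comp, inner_sub_right, compression_comp_compression,
    compression_comp_compression, mulOp_comm hφ hψ]
  ring

end Compression

/-! ### Lipschitz symbols have Hilbert–Schmidt Hankel operators -/

section Kernel

open scoped ComplexConjugate

variable {α : Type*} [MeasurableSpace α] {μ : Measure α} {ι : Type*}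

theorem integrable_conj_mul (x y : Lp ℂ 2 μ) : Integrable (fun s => conj (x s) * y s) μ := by
  have h := L2.integrable_inner (𝕜 := ℂ) x y
  refine h.congr (Eventually.of_forall fun s => ?_)
  simp [mul_comm]

theorem inner_eq_integral (x y : Lp ℂ 2 μ) : ⟪x, y⟫_ℂ = ∫ s, conj (x s) * y s ∂μ := by
  rw [L2.inner_def]
  refine integral_congr_ae (Eventually.of_forall fun s => ?_)
  simp [mul_comm]

/-- The sum of `‖(1 - P_s) M_ψ e_i‖²` over `i ∈ s`, where `P_s` is the projection onto the span of
the `e_i`, `i ∈ s`. -/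
def defect (s : Finset ι) (e : ι → Lp ℂ 2 μ) (ψ : α → ℂ) (hψ : MemLp ψ ∞ μ) : ℝ :=
  ∑ i ∈ s, (‖mulOp μ ψ hψ (e i)‖ ^ 2 - ∑ j ∈ s, ‖⟪e j, mulOp μ ψ hψ (e i)⟫_ℂ‖ ^ 2)

/-- The reproducing kernel of the span of the orthonormal vectors `e_i`, `i ∈ s`. -/
def finKernel (s : Finset ι) (e : ι → Lp ℂ 2 μ) (p : α × α) : ℂ :=
  ∑ i ∈ s, e i p.1 * conj (e i p.2)

/-- The defect is half the square of the Hilbert–Schmidt norm of the commutator of `M_ψ` with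
`P_s`, whose integral kernel is `(ψ(x) - ψ(y)) K_s(x, y)`. -/
theorem kernel_identity [SFinite μ] (s : Finset ι) {e : ι → Lp ℂ 2 μ} (he : Orthonormal ℂ e)
    {ψ : α → ℂ} (hψ : MemLp ψ ∞ μ) :
    Integrable (fun p : α × α => ‖ψ p.1 - ψ p.2‖ ^ 2 * ‖finKernel s e p‖ ^ 2) (μ.prod μ) ∧
    ∫ p, ‖ψ p.1 - ψ p.2‖ ^ 2 * ‖finKernel s e p‖ ^ 2 ∂(μ.prod μ) = 2 * defect s e ψ hψ := by
  classical
  set M := mulOp μ ψ hψ with hM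
  -- the four one-variable integrands
  let a (i j : ι) (x : α) : ℂ := conj (e i x) * e j x
  let b (i j : ι) (x : α) : ℂ := conj (e i x) * (ψ x * e j x)
  let b' (i j : ι) (x : α) : ℂ := conj (ψ x * e i x) * e j x
  let c (i j : ι) (x : α) : ℂ := conj (ψ x * e i x) * (ψ x * e j x)
  have hae : ∀ i, M (e i) =ᵐ[μ] fun x => ψ x * e i x := fun i => mulOp_apply_ae μ ψ hψ (e i)
  have hb_ae : ∀ i j, (fun x => conj (e i x) * M (e j) x) =ᵐ[μ] b i j := fun i j => by
    filter_upwards [hae j] with x hx; simp only [b, hx]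
  have hb'_ae : ∀ i j, (fun x => conj (M (e i) x) * e j x) =ᵐ[μ] b' i j := fun i j => by
    filter_upwards [hae i] with x hx; simp only [b', hx]
  have hc_ae : ∀ i j, (fun x => conj (M (e i) x) * M (e j) x) =ᵐ[μ] c i j := fun i j => by
    filter_upwards [hae i, hae j] with x hx hy; simp only [c, hx, hy]
  have ia : ∀ i j, Integrable (a i j) μ := fun i j => integrable_conj_mul _ _
  have ib : ∀ i j, Integrable (b i j) μ := fun i j => (integrable_conj_mul _ _).congr (hb_ae i j)
  have ib' : ∀ i j, Integrable (b' i j) μ := fun i j =>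
    (integrable_conj_mul _ _).congr (hb'_ae i j)
  have ic : ∀ i j, Integrable (c i j) μ := fun i j => (integrable_conj_mul _ _).congr (hc_ae i j)
  have va : ∀ i j, ∫ x, a i j x ∂μ = if i = j then 1 else 0 := fun i j => by
    rw [← orthonormal_iff_ite.1 he, inner_eq_integral]
  have vb : ∀ i j, ∫ x, b i j x ∂μ = ⟪e i, M (e j)⟫_ℂ := fun i j => by
    rw [inner_eq_integral, integral_congr_ae (hb_ae i j)]
  have vb' : ∀ i j, ∫ x, b' i j x ∂μ = conj ⟪e j, M (e i)⟫_ℂ := fun i j => by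
    rw [inner_conj_symm, inner_eq_integral, integral_congr_ae (hb'_ae i j)]
  have vc : ∀ i j, ∫ x, c i j x ∂μ = ⟪M (e i), M (e j)⟫_ℂ := fun i j => by
    rw [inner_eq_integral, integral_congr_ae (hc_ae i j)]
  let F (i j : ι) (p : α × α) : ℂ :=
    c j i p.1 * a i j p.2 - b j i p.1 * b' i j p.2 - b' j i p.1 * b i j p.2 + a j i p.1 * c i j p.2
  have iF : ∀ i j, Integrable (F i j) (μ.prod μ) := fun i j =>
    ((((ic j i).mul_prod (ia i j)).sub ((ib j i).mul_prod (ib' i j))).sub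
      ((ib' j i).mul_prod (ib i j))).add ((ia j i).mul_prod (ic i j))
  have vF : ∀ i j, ∫ p, F i j p ∂(μ.prod μ) =
      (if i = j then 2 * (‖M (e i)‖ ^ 2 : ℂ) else 0) - ‖⟪e j, M (e i)⟫_ℂ‖ ^ 2
        - ‖⟪e i, M (e j)⟫_ℂ‖ ^ 2 := fun i j => by
    have h1 := (ic j i).mul_prod (ia i j)
    have h2 := (ib j i).mul_prod (ib' i j)
    have h3 := (ib' j i).mul_prod (ib i j)
    have h4 := (ia j i).mul_prod (ic i j)
    refine (integral_add ((h1.sub h2).sub h3) h4).trans ?_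
    rw [integral_sub' (h1.sub h2) h3, integral_sub' h1 h2,
      integral_prod_mul, integral_prod_mul, integral_prod_mul, integral_prod_mul,
      va, va, vb, vb, vb', vb', vc, vc, RCLike.mul_conj, RCLike.conj_mul]
    split_ifs with h h' h'
    · subst h
      rw [inner_self_eq_norm_sq_to_K]
      simp only [Complex.coe_algebraMap]
      ring
    · exact absurd h.symm h'
    · exact absurd h'.symm h
    · simp only [Complex.coe_algebraMap]
      ring
  have hexp : ∀ p : α × α, ((‖ψ p.1 - ψ p.2‖ ^ 2 * ‖finKernel s e p‖ ^ 2 : ℝ) : ℂ) =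
      ∑ i ∈ s, ∑ j ∈ s, F i j p := fun p => by
    push_cast
    rw [← Complex.mul_conj', ← Complex.mul_conj', finKernel, map_sum, Finset.sum_mul_sum,
      Finset.mul_sum]
    refine Finset.sum_congr rfl fun i _ => ?_
    rw [Finset.mul_sum]
    refine Finset.sum_congr rfl fun j _ => ?_
    simp only [F, a, b, b', c, map_mul, map_sub, RingHomCompTriple.comp_apply, RingHom.id_apply]
    ring
  have iS : Integrable (fun p => ∑ i ∈ s, ∑ j ∈ s, F i j p) (μ.prod μ) :=
    integrable_finsetSum _ fun i _ => integrable_finsetSum _ fun j _ => iF i j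
  constructor
  · exact iS.re.congr (Eventually.of_forall fun p => (congrArg Complex.re (hexp p)).symm)
  · apply Complex.ofReal_injective
    rw [← integral_complex_ofReal, integral_congr_ae (Eventually.of_forall hexp),
      integral_finsetSum _ fun i _ => integrable_finsetSum _ fun j _ => iF i j]
    simp only [integral_finsetSum _ fun j _ => iF _ j, vF, Finset.sum_sub_distrib, defect]
    rw [Finset.sum_comm (f := fun i j => (‖⟪e i, M (e j)⟫_ℂ‖ : ℂ) ^ 2)]
    simp only [Finset.sum_ite_eq]
    push_cast
    rw [Finset.sum_congr rfl fun i hi => if_pos hi, ← Finset.mul_sum]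
    ring

/-- If `ψ₁` varies at most `L` times as much as `ψ₂`, then its defect is at most `L²` times as
large. -/
theorem defect_le [SFinite μ] (s : Finset ι) {e : ι → Lp ℂ 2 μ} (he : Orthonormal ℂ e)
    {ψ₁ ψ₂ : α → ℂ} (h₁ : MemLp ψ₁ ∞ μ) (h₂ : MemLp ψ₂ ∞ μ) {L : ℝ}
    (hL : ∀ᵐ p ∂(μ.prod μ), ‖ψ₁ p.1 - ψ₁ p.2‖ ≤ L * ‖ψ₂ p.1 - ψ₂ p.2‖) :
    defect s e ψ₁ h₁ ≤ L ^ 2 * defect s e ψ₂ h₂ := by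
  obtain ⟨i1, v1⟩ := kernel_identity s he h₁
  obtain ⟨i2, v2⟩ := kernel_identity s he h₂
  have h : 2 * defect s e ψ₁ h₁ ≤ L ^ 2 * (2 * defect s e ψ₂ h₂) := by
    rw [← v1, ← v2, ← integral_const_mul]
    refine integral_mono_ae i1 (i2.const_mul _) ?_
    filter_upwards [hL] with p hp
    have := pow_le_pow_left₀ (norm_nonneg _) hp 2
    rw [mul_pow] at this
    calc _ ≤ L ^ 2 * ‖ψ₂ p.1 - ψ₂ p.2‖ ^ 2 * ‖finKernel s e p‖ ^ 2 := by gcongr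
      _ = _ := by ring
  linarith

/-- By Bessel's inequality, since `P_s ≤ P`, the defect dominates the corresponding sum for the
Hankel operator. -/
theorem sum_norm_hankel_sq_le {K : Submodule ℂ (Lp ℂ 2 μ)} [K.HasOrthogonalProjection]
    (s : Finset ι) {e : ι → K} (he : Orthonormal ℂ e) {ψ : α → ℂ} (hψ : MemLp ψ ∞ μ) :
    ∑ i ∈ s, ‖hankel K ψ hψ (e i)‖ ^ 2 ≤ defect s (fun i => (e i : Lp ℂ 2 μ)) ψ hψ := by
  refine Finset.sum_le_sum fun i _ => ?_
  have h1 : ‖mulOp μ ψ hψ (e i)‖ ^ 2 =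
      ‖compression μ K ψ hψ (e i)‖ ^ 2 + ‖hankel K ψ hψ (e i)‖ ^ 2 := by
    have h2 : mulOp μ ψ hψ (e i) =
        (compression μ K ψ hψ (e i) : Lp ℂ 2 μ) + hankel K ψ hψ (e i) := by
      rw [hankel_apply]; exact (add_sub_cancel _ _).symm
    rw [h2, sq, sq, sq, norm_add_sq_eq_norm_sq_add_norm_sq_of_inner_eq_zero _ _
      (inner_hankel hψ _ _)]
    rfl
  have h3 := he.sum_inner_products_le (compression μ K ψ hψ (e i)) (s := s)
  simp only [inner_compression] at h3
  linarith

end Kernel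

/-! ### Spaces spanned by the powers of a coordinate function -/

section DiskModel

open scoped ComplexConjugate NNReal

/-- The common structure of the Hardy space and of the weighted Bergman spaces: the powers of a
coordinate function `φ` with values in the closed unit disk belong to `K ⊆ L²(μ)`, are pairwise
orthogonal and total in `K`, and the ratio of the norms of consecutive powers tends to `1`. Here
`u n` is the class of `φ ^ n`. -/
structure IsDiskModel {α : Type*} [MeasurableSpace α] (μ : Measure α) (K : Submodule ℂ (Lp ℂ 2 μ))
    (φ : α → ℂ) (u : ℕ → K) : Prop where
  measurable : Measurable φ
  mem_closedBall : ∀ᵐ x ∂μ, φ x ∈ Metric.closedBall 0 1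
  coe_ae : ∀ n, (u n : Lp ℂ 2 μ) =ᵐ[μ] fun x => φ x ^ n
  ne_zero : ∀ n, u n ≠ 0
  orthogonal : Pairwise fun i j => ⟪u i, u j⟫_ℂ = 0
  total : ∀ h : K, (∀ n, ⟪u n, h⟫_ℂ = 0) → h = 0
  tendsto_ratio : Tendsto (fun n => ‖u (n + 1)‖ ^ 2 / ‖u n‖ ^ 2) atTop (𝓝 1)

variable {α : Type*} [MeasurableSpace α] {μ : Measure α}
  {K : Submodule ℂ (Lp ℂ 2 μ)} {φ : α → ℂ} {u : ℕ → K}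

-- Restatements of general facts, with the module structure of `K` in the form in which it is found
-- for a subspace of `L²(μ)`; the general ones do not match syntactically when rewriting.
theorem inner_smul_right_subspace (x y : K) (c : ℂ) : ⟪x, c • y⟫_ℂ = c * ⟪x, y⟫_ℂ :=
  inner_smul_right x y c

theorem inner_smul_left_subspace (x y : K) (c : ℂ) : ⟪c • x, y⟫_ℂ = conj c * ⟪x, y⟫_ℂ :=
  inner_smul_left x y c

theorem inner_self_subspace (x : K) : ⟪x, x⟫_ℂ = ((‖x‖ ^ 2 : ℝ) : ℂ) := by
  have h : ⟪x, x⟫_ℂ = (‖x‖ : ℂ) ^ 2 := inner_self_eq_norm_sq_to_K x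
  rw [h]
  norm_cast

/-- The monomial `z ^ a * conj z ^ b`. -/
def monom (a b : ℕ) (z : ℂ) : ℂ := z ^ a * conj z ^ b

namespace IsDiskModel

theorem memLp (hu : IsDiskModel μ K φ u) {f : ℂ → ℂ}
    (hf : ContinuousOn f (Metric.closedBall 0 1)) : MemLp (fun x => f (φ x)) ∞ μ := by
  obtain ⟨C, hC⟩ := (isCompact_closedBall (0 : ℂ) 1).exists_bound_of_continuousOn hf
  refine memLp_top_of_bound (C := C) ?_ (hu.mem_closedBall.mono fun x hx => hC _ hx)
  have h : Measurable ((Metric.closedBall (0 : ℂ) 1).indicator f) := by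
    classical
    rw [← Set.piecewise_eq_indicator]
    exact ContinuousOn.measurable_piecewise hf continuousOn_const measurableSet_closedBall
  refine (h.comp hu.measurable).aestronglyMeasurable.congr ?_
  filter_upwards [hu.mem_closedBall] with x hx
  exact Set.indicator_of_mem hx f

theorem inner_eq (hu : IsDiskModel μ K φ u) (i j : ℕ) :
    ⟪u i, u j⟫_ℂ = if i = j then ((‖u i‖ ^ 2 : ℝ) : ℂ) else 0 := by
  split_ifs with h
  · rw [h, inner_self_subspace]
  · exact hu.orthogonal h

theorem inner_mulOp_monom (hu : IsDiskModel μ K φ u) (a b i j : ℕ)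
    (h : MemLp (fun x => monom a b (φ x)) ∞ μ) :
    ⟪(u i : Lp ℂ 2 μ), mulOp μ _ h (u j)⟫_ℂ = ⟪u (i + b), u (j + a)⟫_ℂ := by
  rw [Submodule.coe_inner, inner_eq_integral, inner_eq_integral]
  refine integral_congr_ae ?_
  filter_upwards [mulOp_apply_ae μ _ h (u j), hu.coe_ae i, hu.coe_ae j, hu.coe_ae (i + b),
    hu.coe_ae (j + a)] with x h1 h2 h3 h4 h5
  rw [h1, h2, h3, h4, h5, monom]
  simp only [map_pow]
  ring

theorem norm_pos (hu : IsDiskModel μ K φ u) (n : ℕ) : 0 < ‖u n‖ := norm_pos_iff.2 (hu.ne_zero n)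

theorem mulOp_coord (hu : IsDiskModel μ K φ u) (n : ℕ) (h : MemLp φ ∞ μ) :
    mulOp μ φ h (u n) = u (n + 1) := by
  apply Lp.ext
  filter_upwards [mulOp_apply_ae μ φ h (u n), hu.coe_ae n, hu.coe_ae (n + 1)] with x h1 h2 h3
  rw [h1, h2, h3, pow_succ']

theorem norm_succ_le (hu : IsDiskModel μ K φ u) (n : ℕ) : ‖u (n + 1)‖ ≤ ‖u n‖ := by
  change ‖(u (n + 1) : Lp ℂ 2 μ)‖ ≤ ‖(u n : Lp ℂ 2 μ)‖
  refine Lp.norm_le_norm_of_ae_le ?_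
  filter_upwards [hu.coe_ae n, hu.coe_ae (n + 1), hu.mem_closedBall] with x h1 h2 h3
  rw [h1, h2, norm_pow, norm_pow]
  exact pow_le_pow_of_le_one (norm_nonneg _) (mem_closedBall_zero_iff.1 h3) n.le_succ

/-- The action of a Toeplitz operator with monomial symbol on the monomials. -/
theorem compression_monom [CompleteSpace K] (hu : IsDiskModel μ K φ u) (a b n : ℕ)
    (h : MemLp (fun x => monom a b (φ x)) ∞ μ) :
    compression μ K _ h (u n) = if b ≤ n + a then
      ((‖u (n + a)‖ ^ 2 / ‖u (n + a - b)‖ ^ 2 : ℝ) : ℂ) • u (n + a - b) else 0 := by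
  rw [← sub_eq_zero]
  refine hu.total _ fun j => ?_
  rw [inner_sub_right, inner_compression, hu.inner_mulOp_monom, hu.inner_eq, sub_eq_zero]
  split_ifs with h1 h2 h2
  · have h3 : j = n + a - b := by omega
    rw [inner_smul_right_subspace, hu.inner_eq, if_pos h3, ← Complex.ofReal_mul, h1, h3,
      div_mul_cancel₀ _ (pow_ne_zero 2 (hu.norm_pos _).ne')]
  · omega
  · rw [inner_smul_right_subspace, hu.inner_eq, if_neg (by omega), mul_zero]
  · rw [inner_zero_right]

/-- The normalized monomials. -/
def unit (u : ℕ → K) (n : ℕ) : K := ((‖u n‖⁻¹ : ℝ) : ℂ) • u n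

theorem orthonormal_unit (hu : IsDiskModel μ K φ u) : Orthonormal ℂ (unit u) := by
  classical
  rw [orthonormal_iff_ite]
  intro i j
  have := hu.norm_pos j
  rw [unit, unit, inner_smul_left_subspace, inner_smul_right_subspace, hu.inner_eq]
  split_ifs with h
  · subst h
    rw [Complex.conj_ofReal, ← Complex.ofReal_mul, ← Complex.ofReal_mul, ← Complex.ofReal_one]
    congr 1
    field_simp
  · simp

/-- The orthonormal basis of `K` formed by the normalized monomials. -/
def basis [CompleteSpace K] (hu : IsDiskModel μ K φ u) : HilbertBasis ℕ ℂ K :=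
  HilbertBasis.mkOfOrthogonalEqBot hu.orthonormal_unit <| by
    rw [Submodule.eq_bot_iff]
    intro x hx
    refine hu.total x fun n => ?_
    have h := (Submodule.mem_orthogonal _ _).1 hx (unit u n) (Submodule.subset_span ⟨n, rfl⟩)
    rw [unit, inner_smul_left_subspace] at h
    refine (mul_eq_zero.1 h).resolve_left ?_
    have := hu.norm_pos n
    simpa using hu.ne_zero n

theorem coe_basis [CompleteSpace K] (hu : IsDiskModel μ K φ u) : ⇑hu.basis = unit u :=
  HilbertBasis.coe_mkOfOrthogonalEqBot _ _

theorem inner_unit_apply (hu : IsDiskModel μ K φ u) (T : K →L[ℂ] K) (n : ℕ) :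
    ⟪unit u n, T (unit u n)⟫_ℂ = ⟪u n, T (u n)⟫_ℂ / ((‖u n‖ ^ 2 : ℝ) : ℂ) := by
  rw [unit, map_smul, inner_smul_left_subspace, inner_smul_right_subspace, Complex.conj_ofReal]
  push_cast
  have : (‖u n‖ : ℂ) ≠ 0 := Complex.ofReal_ne_zero.2 (hu.norm_pos n).ne'
  field_simp

/-- For the coordinate itself only the last monomial contributes to the defect, because
multiplication by the coordinate maps each monomial to the next one. -/
theorem defect_coord_le (hu : IsDiskModel μ K φ u) (N : ℕ) (h : MemLp φ ∞ μ) :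
    defect (Finset.range N) (fun i => (unit u i : Lp ℂ 2 μ)) φ h ≤ 1 := by
  have hM : ∀ n, mulOp μ φ h (unit u n) = ((‖u n‖⁻¹ : ℝ) : ℂ) • (u (n + 1) : Lp ℂ 2 μ) := by
    intro n
    rw [unit, Submodule.coe_smul, map_smul, hu.mulOp_coord]
  have hn : ∀ n, ‖mulOp μ φ h (unit u n)‖ ^ 2 = (‖u n‖⁻¹ * ‖u (n + 1)‖) ^ 2 := by
    intro n
    rw [hM, norm_smul, Complex.norm_real, norm_inv, norm_norm]
    rfl
  have hi : ∀ n, ‖⟪(unit u (n + 1) : Lp ℂ 2 μ), mulOp μ φ h (unit u n)⟫_ℂ‖ ^ 2 =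
      (‖u n‖⁻¹ * ‖u (n + 1)‖) ^ 2 := by
    intro n
    have := hu.norm_pos (n + 1)
    rw [hM, inner_smul_right, unit, Submodule.coe_smul, inner_smul_left, ← Submodule.coe_inner,
      hu.inner_eq, if_pos rfl, Complex.conj_ofReal, ← Complex.ofReal_mul, ← Complex.ofReal_mul,
      Complex.norm_real, Real.norm_eq_abs, sq_abs]
    congr 1
    field_simp
  cases N with
  | zero => simp [defect]
  | succ N =>
    rw [defect, Finset.sum_range_succ]
    have h1 : ∀ n ∈ Finset.range N, ‖mulOp μ φ h (unit u n)‖ ^ 2 -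
        ∑ j ∈ Finset.range (N + 1),
          ‖⟪(unit u j : Lp ℂ 2 μ), mulOp μ φ h (unit u n)⟫_ℂ‖ ^ 2 ≤ 0 := by
      intro n hnN
      rw [sub_nonpos, hn, ← hi]
      refine Finset.single_le_sum
        (f := fun j => ‖⟪(unit u j : Lp ℂ 2 μ), mulOp μ φ h (unit u n)⟫_ℂ‖ ^ 2)
        (fun j _ => by positivity) ?_
      have := Finset.mem_range.1 hnN
      exact Finset.mem_range.2 (by omega)
    have h2 : ‖mulOp μ φ h (unit u N)‖ ^ 2 ≤ 1 := by
      rw [hn]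
      have := hu.norm_pos N
      refine pow_le_one₀ (by positivity) ?_
      rw [inv_mul_le_iff₀ this, mul_one]
      exact hu.norm_succ_le N
    have h3 : 0 ≤ ∑ j ∈ Finset.range (N + 1),
        ‖⟪(unit u j : Lp ℂ 2 μ), mulOp μ φ h (unit u N)⟫_ℂ‖ ^ 2 :=
      Finset.sum_nonneg fun _ _ => by positivity
    linarith [Finset.sum_nonpos h1]

theorem hsNormSq_hankel_le [CompleteSpace K] [SFinite μ] (hu : IsDiskModel μ K φ u)
    {f : ℂ → ℂ} {L : ℝ≥0}
    (hf : LipschitzOnWith L f (Metric.closedBall 0 1)) (h : MemLp (fun x => f (φ x)) ∞ μ) :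
    hsNormSq (hankel K _ h) ≤ ENNReal.ofReal ((L : ℝ) ^ 2) := by
  have hφ : MemLp φ ∞ μ := hu.memLp continuousOn_id
  have hon : Orthonormal ℂ fun i => (unit u i : Lp ℂ 2 μ) :=
    hu.orthonormal_unit.comp_linearIsometry K.subtypeₗᵢ
  rw [← tsum_enorm_sq_eq hu.basis, hu.coe_basis]
  refine ENNReal.tsum_le_of_sum_range_le fun N => ?_
  have h1 : ∑ i ∈ Finset.range N, ‖hankel K _ h (unit u i)‖ ^ 2 ≤ (L : ℝ) ^ 2 := by
    refine (sum_norm_hankel_sq_le _ hu.orthonormal_unit h).trans ?_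
    refine (defect_le (ψ₂ := φ) _ hon h hφ (L := L) ?_).trans ?_
    · have e1 := Measure.quasiMeasurePreserving_fst (μ := μ) (ν := μ) |>.ae hu.mem_closedBall
      have e2 := Measure.quasiMeasurePreserving_snd (μ := μ) (ν := μ) |>.ae hu.mem_closedBall
      filter_upwards [e1, e2] with p h1 h2
      simpa [dist_eq_norm] using hf.dist_le_mul _ h1 _ h2
    · exact mul_le_of_le_one_right (by positivity) (hu.defect_coord_le N hφ)
  refine le_trans (le_of_eq ?_) (ENNReal.ofReal_le_ofReal h1)
  rw [ENNReal.ofReal_sum_of_nonneg fun _ _ => by positivity]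
  simp only [← ofReal_norm, ENNReal.ofReal_pow (norm_nonneg _)]

/-- Commutators of Toeplitz operators with Lipschitz symbols are trace class, and their traces are
controlled by the Lipschitz constants alone. -/
theorem exists_hasTrace [CompleteSpace K] [SFinite μ] (hu : IsDiskModel μ K φ u)
    {f g : ℂ → ℂ} {L M : ℝ≥0}
    (hf : LipschitzOnWith L f (Metric.closedBall 0 1))
    (hg : LipschitzOnWith M g (Metric.closedBall 0 1)) (hf' : MemLp (fun x => f (φ x)) ∞ μ)
    (hg' : MemLp (fun x => g (φ x)) ∞ μ) :
    ∃ a : ℂ, ‖a‖ ≤ 2 * (L * M) ∧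
      HasTrace ⁅compression μ K _ hf', compression μ K _ hg'⁆ a := by
  have hconj : ∀ {f : ℂ → ℂ} {L : ℝ≥0}, LipschitzOnWith L f (Metric.closedBall 0 1) →
      LipschitzOnWith L (fun z => conj (f z)) (Metric.closedBall 0 1) := by
    intro f L hf
    simpa using! Complex.isometry_conj.lipschitz.comp_lipschitzOnWith hf
  have h1 := hu.hsNormSq_hankel_le hf hf'
  have h2 := hu.hsNormSq_hankel_le hg hg'
  have h3 := hu.hsNormSq_hankel_le (hconj hf) (memLp_conj hf')
  have h4 := hu.hsNormSq_hankel_le (hconj hg) (memLp_conj hg')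
  have top : ∀ {T : K →L[ℂ] Lp ℂ 2 μ} {a : ℝ}, hsNormSq T ≤ ENNReal.ofReal a → hsNormSq T ≠ ∞ :=
    fun h => ne_top_of_le_ne_top ENNReal.ofReal_ne_top h
  refine ⟨_, ?_, hasTrace_of_hilbertSchmidt (top h4) (top h1) (top h3) (top h2) ?_⟩
  · refine (norm_sub_le _ _).trans ?_
    have e1 := norm_hsInner_le M.2 L.2 h4 h1
    have e2 := norm_hsInner_le L.2 M.2 h3 h2
    simp only [NNReal.val_eq_coe] at e1 e2
    linarith
  · ext1 y
    refine ext_inner_left ℂ fun x => ?_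
    rw [inner_commutator, sub_apply, inner_sub_right, ContinuousLinearMap.comp_apply,
      ContinuousLinearMap.comp_apply, ContinuousLinearMap.adjoint_inner_right,
      ContinuousLinearMap.adjoint_inner_right]

theorem tendsto_ratio_add (hu : IsDiskModel μ K φ u) (j : ℕ) :
    Tendsto (fun n => ‖u (n + j)‖ ^ 2 / ‖u n‖ ^ 2) atTop (𝓝 1) := by
  induction j with
  | zero =>
    refine tendsto_const_nhds.congr fun n => ?_
    rw [add_zero, div_self (pow_ne_zero 2 (hu.norm_pos n).ne')]
  | succ j ih =>
    have h := ((tendsto_add_atTop_iff_nat j).2 hu.tendsto_ratio).mul ih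
    rw [one_mul] at h
    refine h.congr fun n => ?_
    rw [div_mul_div_cancel₀ (pow_ne_zero 2 (hu.norm_pos _).ne'), add_assoc]

theorem inner_unit_compression_monom [CompleteSpace K] (hu : IsDiskModel μ K φ u)
    (a b c d n : ℕ) (h : MemLp (fun x => monom a b (φ x)) ∞ μ)
    (h' : MemLp (fun x => monom c d (φ x)) ∞ μ) :
    ⟪unit u n, compression μ K _ h (compression μ K _ h' (unit u n))⟫_ℂ =
      if a + c = b + d ∧ d ≤ n + c then ((‖u (n + c)‖ ^ 2 * ‖u (n + b)‖ ^ 2 /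
        (‖u (n + c - d)‖ ^ 2 * ‖u n‖ ^ 2) : ℝ) : ℂ) else 0 := by
  have h0 := hu.inner_unit_apply (compression μ K _ h ∘L compression μ K _ h') n
  simp only [ContinuousLinearMap.comp_apply] at h0
  rw [h0, hu.compression_monom c d n h']
  split_ifs with h1 h2 h2
  · rw [map_smul, hu.compression_monom a b _ h, if_pos (by omega),
      show n + c - d + a - b = n by omega, show n + c - d + a = n + b by omega,
      inner_smul_right_subspace, inner_smul_right_subspace, inner_self_subspace,
      ← Complex.ofReal_mul, ← Complex.ofReal_mul, ← Complex.ofReal_div]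
    have e1 := hu.norm_pos n
    have e2 := hu.norm_pos (n + c - d)
    congr 1
    field_simp
  · rw [map_smul, hu.compression_monom a b _ h, inner_smul_right_subspace]
    split_ifs with h3
    · rw [inner_smul_right_subspace, hu.inner_eq, if_neg (by omega)]
      simp
    · simp
  · omega
  · simp

/-- If the symbols are homogeneous of degrees `k ≥ 0` and `-k`, then the sum of the diagonal
entries telescopes to `-k` times a limit of ratios of norms. -/
theorem trace_monom_of_le [CompleteSpace K] (hu : IsDiskModel μ K φ u) {a b c d : ℕ}
    (hab : a + c = b + d → b ≤ a) (h : MemLp (fun x => monom a b (φ x)) ∞ μ)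
    (h' : MemLp (fun x => monom c d (φ x)) ∞ μ) {t : ℂ}
    (ht : HasSum (fun n => ⟪unit u n, ⁅compression μ K _ h, compression μ K _ h'⁆ (unit u n)⟫_ℂ)
      t) : t = if a + c = b + d then (b : ℂ) - a else 0 := by
  simp only [Ring.lie_def, sub_apply, mul_apply_eq_comp, inner_sub_right,
    hu.inner_unit_compression_monom] at ht
  split_ifs with hd
  · obtain ⟨k, rfl⟩ := Nat.exists_eq_add_of_le (hab hd)
    obtain rfl : d = c + k := by omega
    let s (n : ℕ) : ℝ := ‖u (n + (c + k))‖ ^ 2 * ‖u (n + (b + k))‖ ^ 2 /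
      (‖u (n + k)‖ ^ 2 * ‖u n‖ ^ 2)
    -- the diagonal entries are `s (n - k) - s n` with `s (n - k)` read as `0` for `n < k`
    have hs : Tendsto s atTop (𝓝 1) := by
      have h1 := (((tendsto_add_atTop_iff_nat k).2 (hu.tendsto_ratio_add c))).mul
        (hu.tendsto_ratio_add (b + k))
      rw [one_mul] at h1
      refine h1.congr fun n => ?_
      rw [div_mul_div_comm, show n + k + c = n + (c + k) by ring]
    have h2 : HasSum (fun n => (((if k ≤ n then s (n - k) else 0) - s n : ℝ) : ℂ)) t := by
      convert! ht using 1
      ext n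
      rw [if_pos (c := c + (b + k) = c + k + b ∧ b ≤ n + (b + k)) ⟨by omega, by omega⟩,
        show n + (b + k) - b = n + k by omega, Complex.ofReal_sub]
      congr 1
      · split_ifs with h3 h4 h4
        · obtain ⟨j, rfl⟩ := Nat.exists_eq_add_of_le' h3
          rw [Nat.add_sub_cancel, show j + k + c - (c + k) = j by omega,
            show j + k + c = j + (c + k) by ring, show j + k + b = j + (b + k) by ring,
            mul_comm (‖u j‖ ^ 2)]
        · omega
        · omega
        · simp
      · rw [mul_comm (‖u (n + (b + k))‖ ^ 2)]
    have hsum : ∀ N, ∑ n ∈ Finset.range (N + k), ((if k ≤ n then s (n - k) else 0) - s n) =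
        -∑ i ∈ Finset.range k, s (N + i) := by
      intro N
      have e1 : ∑ n ∈ Finset.range (N + k), (if k ≤ n then s (n - k) else 0) =
          ∑ n ∈ Finset.range N, s n := by
        rw [add_comm N k, Finset.sum_range_add]
        rw [Finset.sum_eq_zero fun n hn => if_neg (by have := Finset.mem_range.1 hn; omega),
          zero_add]
        refine Finset.sum_congr rfl fun n _ => ?_
        rw [if_pos (by omega), Nat.add_sub_cancel_left]
      rw [Finset.sum_sub_distrib, e1, Finset.sum_range_add]
      ring
    have h3 : Tendsto (fun N => -∑ i ∈ Finset.range k, s (N + i)) atTop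
        (𝓝 (-∑ i ∈ Finset.range k, 1)) :=
      (tendsto_finsetSum _ fun i _ => (tendsto_add_atTop_iff_nat i).2 hs).neg
    have h4 := (tendsto_add_atTop_iff_nat k).2 h2.tendsto_sum_nat
    have h5 := (Complex.continuous_ofReal.tendsto _).comp h3
    refine tendsto_nhds_unique h4 (h5.congr fun N => ?_) |>.trans ?_
    · rw [Function.comp_apply, ← hsum, Complex.ofReal_sum]
    · simp
  · refine ht.unique ?_
    convert! hasSum_zero with n
    rw [if_neg (by omega), if_neg (by omega), sub_zero]

theorem inner_lie_swap (S T : K →L[ℂ] K) (x y : K) :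
    ⟪x, ⁅S, T⁆ y⟫_ℂ = -⟪x, ⁅T, S⁆ y⟫_ℂ := by
  simp only [Ring.lie_def, sub_apply, inner_sub_right]
  ring

theorem trace_monom [CompleteSpace K] (hu : IsDiskModel μ K φ u) {a b c d : ℕ}
    (h : MemLp (fun x => monom a b (φ x)) ∞ μ) (h' : MemLp (fun x => monom c d (φ x)) ∞ μ) {t : ℂ}
    (ht : HasSum (fun n => ⟪unit u n, ⁅compression μ K _ h, compression μ K _ h'⁆ (unit u n)⟫_ℂ)
      t) : t = if a + c = b + d then (b : ℂ) - a else 0 := by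
  rcases le_total b a with hab | hab
  · exact hu.trace_monom_of_le (fun _ => hab) h h' ht
  · have h1 := ht.neg
    simp only [← inner_lie_swap] at h1
    have h2 := neg_eq_iff_eq_neg.1
      (hu.trace_monom_of_le (a := c) (b := d) (fun _ => by omega) h' h h1)
    rw [h2]
    split_ifs with h3 h4 h4
    · have h5 : (a : ℂ) + c = b + d := mod_cast h4
      linear_combination h5
    · omega
    · omega
    · simp

end IsDiskModel

end DiskModel

/-! ### The integral of `df ∧ dg` -/

section Wedge

open scoped ComplexConjugate NNReal

/-- The right-hand side of the trace formula, `(2πi)⁻¹ ∫ df ∧ dg`. -/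
def wedgeIntegral (f g : ℂ → ℂ) : ℂ :=
  1 / (2 * Real.pi * Complex.I) * ∫ z in Metric.ball (0 : ℂ) 1, wedgeCoeff f g z

theorem exists_lipschitzOnWith {E : Type*} [NormedAddCommGroup E] [NormedSpace ℝ E] {f : ℂ → E}
    (hf : ContDiffOn ℝ 1 f (Metric.closedBall 0 1)) :
    ∃ L : ℝ≥0, LipschitzOnWith L f (Metric.closedBall 0 1) := by
  have hu : UniqueDiffOn ℝ (Metric.closedBall (0 : ℂ) 1) :=
    uniqueDiffOn_convex (convex_closedBall _ _) (by rw [interior_closedBall _ one_ne_zero]; simp)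
  obtain ⟨C, hC⟩ := (isCompact_closedBall (0 : ℂ) 1).exists_bound_of_continuousOn
    (hf.continuousOn_fderivWithin hu le_rfl)
  refine ⟨C.toNNReal, (convex_closedBall _ _).lipschitzOnWith_of_nnnorm_fderivWithin_le
    (𝕜 := ℝ) (hf.differentiableOn one_ne_zero) fun z hz => ?_⟩
  exact NNReal.le_toNNReal_of_coe_le (hC z hz)

theorem norm_fderiv_le {f : ℂ → ℂ} {L : ℝ≥0} (hf : LipschitzOnWith L f (Metric.closedBall 0 1))
    {z : ℂ} (hz : z ∈ Metric.ball (0 : ℂ) 1) : ‖fderiv ℝ f z‖ ≤ L :=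
  norm_fderiv_le_of_lipschitzOn ℝ
    (mem_of_superset (Metric.isOpen_ball.mem_nhds hz) Metric.ball_subset_closedBall) hf

theorem norm_wedgeCoeff_le {f g : ℂ → ℂ} {L M : ℝ≥0}
    (hf : LipschitzOnWith L f (Metric.closedBall 0 1))
    (hg : LipschitzOnWith M g (Metric.closedBall 0 1)) {z : ℂ} (hz : z ∈ Metric.ball (0 : ℂ) 1) :
    ‖wedgeCoeff f g z‖ ≤ 2 * (L * M) := by
  have bd : ∀ {f : ℂ → ℂ} {L : ℝ≥0}, LipschitzOnWith L f (Metric.closedBall 0 1) →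
      ∀ v : ℂ, ‖v‖ = 1 → ‖fderiv ℝ f z v‖ ≤ L := fun hf v hv =>
    (ContinuousLinearMap.le_opNorm _ _).trans (by rw [hv, mul_one]; exact norm_fderiv_le hf hz)
  calc ‖wedgeCoeff f g z‖ ≤ ‖fderiv ℝ f z 1‖ * ‖fderiv ℝ g z Complex.I‖ +
        ‖fderiv ℝ f z Complex.I‖ * ‖fderiv ℝ g z 1‖ := by
        rw [wedgeCoeff, ← norm_mul, ← norm_mul]
        exact norm_sub_le _ _
    _ ≤ L * M + L * M := by
        gcongr
        exacts [bd hf _ norm_one, bd hg _ Complex.norm_I, bd hf _ Complex.norm_I,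
          bd hg _ norm_one]
    _ = _ := by ring

theorem integrableOn_wedgeCoeff {f g : ℂ → ℂ} (hf : ContDiffOn ℝ 1 f (Metric.closedBall 0 1))
    (hg : ContDiffOn ℝ 1 g (Metric.closedBall 0 1)) :
    IntegrableOn (wedgeCoeff f g) (Metric.ball 0 1) := by
  obtain ⟨L, hL⟩ := exists_lipschitzOnWith hf
  obtain ⟨M, hM⟩ := exists_lipschitzOnWith hg
  have cont : ∀ {f : ℂ → ℂ}, ContDiffOn ℝ 1 f (Metric.closedBall 0 1) → ∀ v : ℂ,
      ContinuousOn (fun z => fderiv ℝ f z v) (Metric.ball 0 1) := fun hf v =>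
    ((hf.mono Metric.ball_subset_closedBall).continuousOn_fderiv_of_isOpen Metric.isOpen_ball
      le_rfl).clm_apply continuousOn_const
  refine IntegrableOn.of_bound measure_ball_lt_top
    (ContinuousOn.aestronglyMeasurable ?_ Metric.isOpen_ball.measurableSet) (2 * (L * M)) ?_
  · exact ((cont hf _).mul (cont hg _)).sub ((cont hf _).mul (cont hg _))
  · filter_upwards [ae_restrict_mem Metric.isOpen_ball.measurableSet] with z hz
    exact norm_wedgeCoeff_le hL hM hz

/-- The constant is `1` because `|df ∧ dg| ≤ 2 L M`, the disk has area `π`, and the prefactor has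
modulus `1 / (2π)`. -/
theorem norm_wedgeIntegral_le {f g : ℂ → ℂ} {L M : ℝ≥0}
    (hf : LipschitzOnWith L f (Metric.closedBall 0 1))
    (hg : LipschitzOnWith M g (Metric.closedBall 0 1)) : ‖wedgeIntegral f g‖ ≤ L * M := by
  have h := norm_setIntegral_le_of_norm_le_const (μ := volume) (C := 2 * (L * M))
    (measure_ball_lt_top (x := (0 : ℂ)) (r := 1)) fun z hz => norm_wedgeCoeff_le hf hg hz
  have hv : volume.real (Metric.ball (0 : ℂ) 1) = Real.pi := by
    simp [Measure.real, Complex.volume_ball]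
  rw [hv] at h
  have hpi := Real.pi_pos
  rw [wedgeIntegral, norm_mul]
  have h1 : ‖1 / (2 * Real.pi * Complex.I)‖ = 1 / (2 * Real.pi) := by
    simp [abs_of_pos hpi]
  rw [h1]
  calc _ ≤ 1 / (2 * Real.pi) * (2 * (L * M) * Real.pi) := by gcongr
    _ = L * M := by field_simp

theorem wedgeIntegral_swap (f g : ℂ → ℂ) : wedgeIntegral g f = -wedgeIntegral f g := by
  have h : wedgeCoeff g f = fun z => -wedgeCoeff f g z := by
    ext z
    rw [wedgeCoeff, wedgeCoeff]
    ring
  rw [wedgeIntegral, wedgeIntegral, h, integral_neg]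
  ring

theorem differentiableAt_of_contDiffOn {f : ℂ → ℂ} (hf : ContDiffOn ℝ 1 f (Metric.closedBall 0 1))
    {z : ℂ} (hz : z ∈ Metric.ball (0 : ℂ) 1) : DifferentiableAt ℝ f z :=
  (hf.differentiableOn one_ne_zero).differentiableAt
    (mem_of_superset (Metric.isOpen_ball.mem_nhds hz) Metric.ball_subset_closedBall)

theorem wedgeIntegral_add {f₁ f₂ g : ℂ → ℂ} (h₁ : ContDiffOn ℝ 1 f₁ (Metric.closedBall 0 1))
    (h₂ : ContDiffOn ℝ 1 f₂ (Metric.closedBall 0 1))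
    (hg : ContDiffOn ℝ 1 g (Metric.closedBall 0 1)) :
    wedgeIntegral (f₁ + f₂) g = wedgeIntegral f₁ g + wedgeIntegral f₂ g := by
  rw [wedgeIntegral, wedgeIntegral, wedgeIntegral, ← mul_add,
    ← integral_add (integrableOn_wedgeCoeff h₁ hg) (integrableOn_wedgeCoeff h₂ hg)]
  congr 1
  refine setIntegral_congr_fun Metric.isOpen_ball.measurableSet fun z hz => ?_
  simp only [wedgeCoeff]
  rw [fderiv_add (differentiableAt_of_contDiffOn h₁ hz) (differentiableAt_of_contDiffOn h₂ hz)]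
  simp only [add_apply]
  ring

theorem wedgeIntegral_smul {f g : ℂ → ℂ} (c : ℂ) (hf : ContDiffOn ℝ 1 f (Metric.closedBall 0 1)) :
    wedgeIntegral (c • f) g = c * wedgeIntegral f g := by
  rw [wedgeIntegral, wedgeIntegral, mul_left_comm, ← integral_const_mul c]
  congr 1
  refine setIntegral_congr_fun Metric.isOpen_ball.measurableSet fun z hz => ?_
  simp only [wedgeCoeff]
  rw [fderiv_const_smul (differentiableAt_of_contDiffOn hf hz)]
  simp only [smul_apply, smul_eq_mul]
  ring

theorem contDiff_monom (a b : ℕ) {n : WithTop ℕ∞} : ContDiff ℝ n (monom a b) :=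
  (contDiff_id.pow a).mul ((Complex.conjCLE.contDiff).pow b)

/-- Monomials of nonzero degree integrate to `0` against radial functions, since a suitable
rotation changes their sign. -/
theorem integral_radial_mul_monom (w : ℝ → ℂ) {a b : ℕ} (hab : a ≠ b) :
    ∫ z : ℂ, w ‖z‖ * monom a b z = 0 := by
  set θ : ℝ := Real.pi / ((a : ℝ) - b) with hθ
  have hne : (a : ℝ) - b ≠ 0 := sub_ne_zero.2 (by exact_mod_cast hab)
  have hc : monom a b (Circle.exp θ) = -1 := by
    rw [monom, ← Circle.coe_inv_eq_conj, ← Circle.exp_neg, Circle.coe_exp, Circle.coe_exp,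
      ← Complex.exp_nat_mul, ← Complex.exp_nat_mul, ← Complex.exp_add, ← Complex.exp_pi_mul_I]
    congr 1
    have h : (θ : ℂ) * ((a : ℂ) - b) = Real.pi := by
      rw [hθ]
      norm_cast
      rw [Int.cast_subNatNat, div_mul_cancel₀ _ hne]
    push_cast
    linear_combination Complex.I * h
  have h1 := (rotation (Circle.exp θ)).measurePreserving.integral_comp
    (rotation (Circle.exp θ)).toHomeomorph.measurableEmbedding
    (fun z : ℂ => w ‖z‖ * monom a b z)
  have h2 : ∀ z : ℂ, w ‖rotation (Circle.exp θ) z‖ * monom a b (rotation (Circle.exp θ) z) =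
      -(w ‖z‖ * monom a b z) := by
    intro z
    have h3 : monom a b (rotation (Circle.exp θ) z) =
        monom a b (Circle.exp θ) * monom a b z := by
      simp only [monom, rotation_apply, map_mul]
      ring
    rw [LinearIsometryEquiv.norm_map, h3, hc]
    ring
  simp only [h2] at h1
  rw [integral_neg] at h1
  exact CharZero.neg_eq_self_iff.1 h1

theorem monom_self (a : ℕ) (z : ℂ) : monom a a z = ((‖z‖ ^ (2 * a) : ℝ) : ℂ) := by
  rw [monom, ← mul_pow, Complex.mul_conj', pow_mul]
  norm_cast

/-- Integration in polar coordinates of a radial function over a disk. -/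
theorem setIntegral_ball_radial (w : ℝ → ℝ) (s : ℝ) :
    ∫ z in Metric.ball (0 : ℂ) s, w ‖z‖ = 2 * Real.pi * ∫ r in Set.Ioo 0 s, r * w r := by
  have h := integral_fun_norm_addHaar (volume : Measure ℂ) ((Set.Iio s).indicator w)
  have h1 : (fun z : ℂ => (Set.Iio s).indicator w ‖z‖) =
      (Metric.ball (0 : ℂ) s).indicator fun z => w ‖z‖ := by
    ext z
    by_cases hz : ‖z‖ < s <;> simp [Set.indicator, hz]
  rw [h1, integral_indicator Metric.isOpen_ball.measurableSet] at h
  rw [h, Complex.finrank_real_complex]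
  have h2 : volume.real (Metric.ball (0 : ℂ) 1) = Real.pi := by
    simp [Measure.real, Complex.volume_ball]
  have h3 : (fun r => r ^ (2 - 1) • (Set.Iio s).indicator w r) =
      (Set.Iio s).indicator fun r => r * w r := by
    ext r
    by_cases hr : r < s <;> simp [Set.indicator, hr]
  rw [h2, h3, setIntegral_indicator measurableSet_Iio, Set.Ioi_inter_Iio]
  simp only [nsmul_eq_mul, smul_eq_mul]
  push_cast
  ring

theorem setIntegral_ball_monom (a b : ℕ) :
    ∫ z in Metric.ball (0 : ℂ) 1, monom a b z = if a = b then (Real.pi : ℂ) / (a + 1) else 0 := by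
  split_ifs with h
  · subst h
    simp only [monom_self]
    rw [integral_complex_ofReal, setIntegral_ball_radial (fun r => r ^ (2 * a)),
      ← integral_Ioc_eq_integral_Ioo, ← intervalIntegral.integral_of_le zero_le_one]
    simp only [← pow_succ']
    rw [integral_pow]
    push_cast
    have : (a : ℂ) + 1 ≠ 0 := Nat.cast_add_one_ne_zero a
    have h2 : (2 * (a : ℂ) + 1 + 1) = 2 * (a + 1) := by ring
    rw [h2]
    simp
    field_simp
  · rw [← integral_indicator Metric.isOpen_ball.measurableSet]
    refine Eq.trans ?_ (integral_radial_mul_monom ((Set.Iio 1).indicator 1) h)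
    refine integral_congr_ae (Eventually.of_forall fun z => ?_)
    by_cases hz : ‖z‖ < 1 <;> simp [Set.indicator, hz]

theorem fderiv_monom (a b : ℕ) (z v : ℂ) : fderiv ℝ (monom a b) z v =
    a * z ^ (a - 1) * conj z ^ b * v + b * z ^ a * conj z ^ (b - 1) * conj v := by
  have h1 := (hasDerivAt_pow a z).hasFDerivAt.restrictScalars ℝ
  have h2 := ((hasDerivAt_pow b (conj z)).hasFDerivAt.restrictScalars ℝ).comp z
    Complex.conjCLE.hasFDerivAt
  have h3 : HasFDerivAt (monom a b) _ z := h1.mul h2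
  rw [h3.fderiv]
  simp
  ring

/-- The truncated subtractions do no harm: if `a + c = 0` or `b + d = 0`, then the coefficient
`a d - b c` vanishes. -/
theorem wedgeCoeff_monom (a b c d : ℕ) (z : ℂ) : wedgeCoeff (monom a b) (monom c d) z =
    -2 * Complex.I * (a * d - b * c) * monom (a + c - 1) (b + d - 1) z := by
  have h1 : ∀ a c : ℕ, (a : ℂ) * z ^ (a - 1) * z ^ c = a * z ^ (a + c - 1) := by
    rintro (_ | a) c
    · simp
    · rw [show a + 1 - 1 = a by omega, show a + 1 + c - 1 = a + c by omega]
      ring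
  have h2 : ∀ a c : ℕ, (a : ℂ) * conj z ^ (a - 1) * conj z ^ c = a * conj z ^ (a + c - 1) := by
    rintro (_ | a) c
    · simp
    · rw [show a + 1 - 1 = a by omega, show a + 1 + c - 1 = a + c by omega]
      ring
  have e1 := h1 a c
  have e2 := h1 c a
  have e3 := h2 b d
  have e4 := h2 d b
  rw [add_comm c a] at e2
  rw [add_comm d b] at e4
  simp only [wedgeCoeff, fderiv_monom, monom, map_one, Complex.conj_I]
  linear_combination (exp := 1)
    -2 * Complex.I * (d * conj z ^ (d - 1) * conj z ^ b) * e1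
    - 2 * Complex.I * (a * z ^ (a + c - 1)) * e4
    + 2 * Complex.I * (b * conj z ^ (b - 1) * conj z ^ d) * e2
    + 2 * Complex.I * (c * z ^ (a + c - 1)) * e3

theorem wedgeIntegral_monom (a b c d : ℕ) : wedgeIntegral (monom a b) (monom c d) =
    if a + c = b + d then (b : ℂ) - a else 0 := by
  rw [wedgeIntegral]
  simp only [wedgeCoeff_monom]
  rw [integral_const_mul, setIntegral_ball_monom]
  have hpi : (Real.pi : ℂ) ≠ 0 := Complex.ofReal_ne_zero.2 Real.pi_ne_zero
  have hI := Complex.I_ne_zero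
  split_ifs with h1 h2 h2
  · rcases Nat.eq_zero_or_pos (a + c) with h3 | h3
    · have : a = 0 ∧ b = 0 ∧ c = 0 ∧ d = 0 := by omega
      obtain ⟨rfl, rfl, rfl, rfl⟩ := this
      simp
    · obtain ⟨s, hs⟩ := Nat.exists_eq_add_of_lt h3
      rw [zero_add] at hs
      rw [hs, Nat.add_sub_cancel]
      have h4 : (s : ℂ) + 1 ≠ 0 := Nat.cast_add_one_ne_zero s
      have h5 : (a : ℂ) + c = s + 1 := mod_cast hs
      have h6 : (b : ℂ) + d = s + 1 := mod_cast h2 ▸ hs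
      field_simp
      linear_combination (b : ℂ) * h5 - a * h6
  · have h3 : (a = 0 ∧ c = 0) ∨ (b = 0 ∧ d = 0) := by omega
    rcases h3 with ⟨rfl, rfl⟩ | ⟨rfl, rfl⟩ <;> simp
  · omega
  · simp

end Wedge

/-! ### Approximation by polynomials in the Lipschitz seminorm -/

section Approximation

open scoped ComplexConjugate NNReal ContDiff

/-- The polynomials in `z` and `conj z`. -/
def polySpan : Submodule ℂ (ℂ → ℂ) := Submodule.span ℂ (Set.range fun p : ℕ × ℕ => monom p.1 p.2)

theorem monom_mem (a b : ℕ) : monom a b ∈ polySpan := Submodule.subset_span ⟨(a, b), rfl⟩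

theorem contDiff_of_mem {p : ℂ → ℂ} (hp : p ∈ polySpan) {n : WithTop ℕ∞} : ContDiff ℝ n p := by
  induction hp using Submodule.span_induction with
  | mem p hp => obtain ⟨x, rfl⟩ := hp; exact contDiff_monom _ _
  | zero => exact contDiff_const
  | add p q _ _ hp hq => exact hp.add hq
  | smul c p _ hp => exact hp.const_smul c

/-- Dilation and a cutoff: a `C²` function on the closed disk is approximated in the Lipschitz
seminorm by functions which are `C²` with compact support in the plane. -/
theorem exists_contDiff_approx {f : ℂ → ℂ} (hf : ContDiffOn ℝ 2 f (Metric.closedBall 0 1)) {ε : ℝ≥0}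
    (hε : 0 < ε) : ∃ F : ℂ → ℂ, ContDiff ℝ 2 F ∧ HasCompactSupport F ∧
      LipschitzOnWith ε (fun z => f z - F z) (Metric.closedBall 0 1) := by
  have hu : UniqueDiffOn ℝ (Metric.closedBall (0 : ℂ) 1) :=
    uniqueDiffOn_convex (convex_closedBall _ _) (by rw [interior_closedBall _ one_ne_zero]; simp)
  set D := fderivWithin ℝ f (Metric.closedBall 0 1) with hD
  have hDc : ContDiffOn ℝ 1 D (Metric.closedBall 0 1) := hf.fderivWithin hu (by norm_num)
  obtain ⟨B, hB⟩ := (isCompact_closedBall (0 : ℂ) 1).exists_bound_of_continuousOn hDc.continuousOn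
  have hB0 : 0 ≤ B := (norm_nonneg _).trans (hB 0 (by simp))
  obtain ⟨M, hM⟩ := exists_lipschitzOnWith hDc
  -- the dilation factor `1 - δ`
  set δ : ℝ := min (1 / 2) (ε / (B + M + 1)) with hδ
  have hδ0 : 0 < δ := lt_min (by norm_num) (by positivity)
  have hδ1 : δ ≤ 1 / 2 := min_le_left _ _
  have hδε : δ * (B + M) ≤ ε := by
    have h1 : δ * (B + M + 1) ≤ ε := by
      rw [← le_div_iff₀ (by positivity)]; exact min_le_right _ _
    nlinarith
  set r : ℝ := 1 - δ with hr
  have hr0 : 0 < r := by linarith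
  have hr1 : r < 1 := by linarith
  have hinv : 1 < r⁻¹ := (one_lt_inv₀ hr0).2 hr1
  let χ : ContDiffBump (0 : ℂ) := ⟨1, (1 + r⁻¹) / 2, one_pos, by linarith⟩
  let F : ℂ → ℂ := fun z => χ z • f (r • z)
  have hmaps : Set.MapsTo (fun z : ℂ => r • z) (Metric.closedBall 0 1) (Metric.closedBall 0 1) := by
    intro z hz
    rw [mem_closedBall_zero_iff] at hz ⊢
    rw [norm_smul, Real.norm_of_nonneg hr0.le]
    exact mul_le_one₀ hr1.le (norm_nonneg _) hz
  refine ⟨F, ?_, ?_, ?_⟩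
  · rw [contDiff_iff_contDiffAt]
    intro z
    by_cases hz : ‖z‖ < r⁻¹
    · have h2 : ContDiffAt ℝ 2 f (r • z) := by
        refine hf.contDiffAt (mem_of_superset (Metric.isOpen_ball.mem_nhds ?_)
          Metric.ball_subset_closedBall)
        rw [mem_ball_zero_iff, norm_smul, Real.norm_of_nonneg hr0.le]
        rwa [← lt_inv_mul_iff₀ hr0, mul_one]
      exact χ.contDiff.contDiffAt.smul (h2.comp z (contDiff_const_smul r).contDiffAt)
    · have h1 : z ∉ tsupport χ := by
        rw [χ.tsupport_eq, mem_closedBall_zero_iff, not_le]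
        change (1 + r⁻¹) / 2 < ‖z‖
        linarith [not_lt.1 hz]
      have h2 : F =ᶠ[𝓝 z] fun _ => 0 := by
        filter_upwards [notMem_tsupport_iff_eventuallyEq.1 h1] with w hw
        simp [F, hw]
      exact contDiffAt_const.congr_of_eventuallyEq h2
  · exact χ.hasCompactSupport.smul_right
  · have hF : ∀ z ∈ Metric.closedBall (0 : ℂ) 1, f z - F z = f z - f (r • z) := by
      intro z hz
      simp only [F]
      rw [χ.one_of_mem_closedBall hz, one_smul]
    -- the derivative of `f z - f (r z)` is small since that of `f` is bounded and Lipschitz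
    have hd : ∀ z ∈ Metric.closedBall (0 : ℂ) 1, HasFDerivWithinAt (fun z => f z - f (r • z))
        (D z - r • D (r • z)) (Metric.closedBall 0 1) z := by
      intro z hz
      have h1 := (hf.differentiableOn two_ne_zero z hz).hasFDerivWithinAt
      have h2 := (hf.differentiableOn two_ne_zero _ (hmaps hz)).hasFDerivWithinAt
      have h3 := h2.comp z (((ContinuousLinearMap.id ℝ ℂ).hasFDerivWithinAt (x := z)).const_smul r)
        hmaps
      convert! h1.sub h3 using 1
      ext v
      simp [D]
    have hbound : ∀ z ∈ Metric.closedBall (0 : ℂ) 1, ‖D z - r • D (r • z)‖ ≤ ε := by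
      intro z hz
      have h1 : D z - r • D (r • z) = δ • D z + r • (D z - D (r • z)) := by
        rw [hr]; module
      have h2 : ‖D z - D (r • z)‖ ≤ M * δ := by
        have h3 := hM.dist_le_mul z hz _ (hmaps hz)
        rw [dist_eq_norm, dist_eq_norm] at h3
        refine h3.trans ?_
        have h4 : z - r • z = δ • z := by rw [hr]; module
        rw [h4, norm_smul, Real.norm_of_nonneg hδ0.le]
        gcongr
        exact mul_le_of_le_one_right hδ0.le (mem_closedBall_zero_iff.1 hz)
      calc ‖D z - r • D (r • z)‖ ≤ δ * ‖D z‖ + r * ‖D z - D (r • z)‖ := by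
            rw [h1]
            refine (norm_add_le _ _).trans ?_
            rw [norm_smul, norm_smul, Real.norm_of_nonneg hδ0.le, Real.norm_of_nonneg hr0.le]
        _ ≤ δ * B + 1 * (M * δ) := by gcongr; exact hB z hz
        _ = δ * (B + M) := by ring
        _ ≤ ε := hδε
    have hlip := (convex_closedBall (0 : ℂ) 1).lipschitzOnWith_of_nnnorm_hasFDerivWithin_le hd
      hbound
    intro z hz z' hz'
    simpa only [hF z hz, hF z' hz'] using hlip hz hz'

/-- The convolution with a polynomial is a polynomial. -/
theorem convolution_mem {F : ℂ → ℂ} (hF : Continuous F) (hFc : HasCompactSupport F) {q : ℂ → ℂ}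
    (hq : q ∈ polySpan) : (fun z => ∫ w, F w * q (z - w)) ∈ polySpan := by
  have hint : ∀ {g : ℂ → ℂ}, Continuous g → Integrable fun w => F w * g w := fun hg =>
    (hF.mul hg).integrable_of_hasCompactSupport hFc.mul_right
  induction hq using Submodule.span_induction with
  | mem q hq =>
    obtain ⟨⟨a, b⟩, rfl⟩ := hq
    have h1 : ∀ z w : ℂ, F w * monom a b (z - w) = ∑ i ∈ Finset.range (a + 1),
        ∑ j ∈ Finset.range (b + 1), F w * ((-w) ^ (a - i) * a.choose i *
          (conj (-w) ^ (b - j) * b.choose j)) * monom i j z := by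
      intro z w
      rw [monom, sub_eq_add_neg, map_add, add_pow, add_pow, Finset.sum_mul_sum, Finset.mul_sum]
      refine Finset.sum_congr rfl fun i _ => ?_
      rw [Finset.mul_sum]
      refine Finset.sum_congr rfl fun j _ => ?_
      rw [monom]
      ring
    have h2 : ∀ (i j : ℕ) (z : ℂ), Integrable fun w => F w * ((-w) ^ (a - i) * a.choose i *
          (conj (-w) ^ (b - j) * b.choose j)) * monom i j z := fun i j z =>
      (hint (by fun_prop)).mul_const _
    have h3 : (fun z => ∫ w, F w * monom a b (z - w)) = ∑ i ∈ Finset.range (a + 1),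
        ∑ j ∈ Finset.range (b + 1), (∫ w, F w * ((-w) ^ (a - i) * a.choose i *
          (conj (-w) ^ (b - j) * b.choose j))) • monom i j := by
      ext z
      simp only [h1, Finset.sum_apply, Pi.smul_apply, smul_eq_mul]
      rw [integral_finsetSum _ fun i _ => integrable_finsetSum _ fun j _ => h2 i j z]
      refine Finset.sum_congr rfl fun i _ => ?_
      rw [integral_finsetSum _ fun j _ => h2 i j z]
      exact Finset.sum_congr rfl fun j _ => integral_mul_const _ _
    simp only [h3]
    exact sum_mem fun i _ => sum_mem fun j _ => polySpan.smul_mem _ (monom_mem i j)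
  | zero =>
    simp only [Pi.zero_apply, mul_zero, integral_zero]
    exact polySpan.zero_mem
  | add p q hp hq hp' hq' =>
    convert! polySpan.add_mem hp' hq' using 1
    ext z
    have cp := (contDiff_of_mem hp (n := 0)).continuous
    have cq := (contDiff_of_mem hq (n := 0)).continuous
    simp only [Pi.add_apply, mul_add]
    exact integral_add (hint (cp.comp (continuous_const.sub continuous_id)))
      (hint (cq.comp (continuous_const.sub continuous_id)))
  | smul c p _ hp' =>
    convert! polySpan.smul_mem c hp' using 1
    ext z
    simp only [Pi.smul_apply, smul_eq_mul]
    rw [← integral_const_mul]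
    congr 1
    ext w
    ring

/-- Translations of a `C²` function with compact support converge to it in the Lipschitz
seminorm, at a linear rate. -/
theorem exists_norm_translate_le {F : ℂ → ℂ} (hF : ContDiff ℝ 2 F) (hFc : HasCompactSupport F) :
    ∃ M : ℝ, 0 ≤ M ∧ ∀ u z z' : ℂ, ‖(F z - F (z - u)) - (F z' - F (z' - u))‖ ≤
      M * ‖u‖ * ‖z - z'‖ := by
  have h1 : ContDiff ℝ 1 (fderiv ℝ F) := hF.fderiv_right (by norm_num)
  obtain ⟨M, hM⟩ := h1.lipschitzWith_of_hasCompactSupport (hFc.fderiv (𝕜 := ℝ)) one_ne_zero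
  refine ⟨M, M.2, fun u z z' => ?_⟩
  have hdiff := hF.differentiable two_ne_zero
  have h2 : ∀ w ∈ (Set.univ : Set ℂ), HasFDerivWithinAt (fun w => F w - F (w - u))
      (fderiv ℝ F w - fderiv ℝ F (w - u)) Set.univ w := fun w _ =>
    ((hdiff w).hasFDerivAt.sub ((hdiff (w - u)).hasFDerivAt.comp w
      ((hasFDerivAt_id w).sub_const u))).hasFDerivWithinAt
  refine convex_univ.norm_image_sub_le_of_norm_hasFDerivWithin_le h2 (fun w _ => ?_)
    (Set.mem_univ z') (Set.mem_univ z)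
  have h3 := hM.dist_le_mul w (w - u)
  simpa [dist_eq_norm] using h3

/-- Convolution with normalized powers of `1 - |u|² / S²` gives polynomial approximations in the
Lipschitz seminorm of `C²` functions with compact support. -/
theorem exists_poly_approx_of_hasCompactSupport {F : ℂ → ℂ} (hF : ContDiff ℝ 2 F)
    (hFc : HasCompactSupport F) {ε : ℝ≥0} (hε : 0 < ε) :
    ∃ p ∈ polySpan, LipschitzOnWith ε (fun z => F z - p z) (Metric.closedBall 0 1) := by
  obtain ⟨M, hM0, hM⟩ := exists_norm_translate_le hF hFc
  obtain ⟨R, hR0, hR⟩ : ∃ R : ℝ, 0 < R ∧ ∀ w, F w ≠ 0 → ‖w‖ ≤ R := by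
    obtain ⟨R, hR⟩ := hFc.isCompact.isBounded.subset_closedBall 0
    refine ⟨max R 1, by positivity, fun w hw => ?_⟩
    exact (mem_closedBall_zero_iff.1 (hR (subset_tsupport F hw))).trans (le_max_left _ _)
  set S : ℝ := R + 1 with hS
  have hS0 : 0 < S := by linarith
  set A : Set ℂ := Metric.closedBall 0 S with hA
  have hAc : IsCompact A := isCompact_closedBall _ _
  let c : ℂ → ℝ := fun u => 1 - ‖u‖ ^ 2 / S ^ 2
  have hcc : Continuous c := by fun_prop
  have hc0 : ∀ u ∈ A, 0 ≤ c u := by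
    intro u hu
    have h1 : ‖u‖ ≤ S := mem_closedBall_zero_iff.1 hu
    have h2 : ‖u‖ ^ 2 / S ^ 2 ≤ 1 := (div_le_one (by positivity)).2 (by gcongr)
    simp only [c]
    linarith
  have hpeak := tendsto_setIntegral_pow_smul_of_unique_maximum_of_isCompact_of_continuousOn
    (μ := (volume : Measure ℂ)) (s := A) (c := c) (g := fun u => ‖u‖) (x₀ := 0) hAc
    hcc.continuousOn (fun y _ hy => by
      have : 0 < ‖y‖ := norm_pos_iff.2 hy
      have : 0 < ‖y‖ ^ 2 / S ^ 2 := by positivity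
      simp only [c]
      simpa using this) hc0 (by simp [c])
    (by
      rw [hA, interior_closedBall _ hS0.ne']
      exact subset_closure (Metric.mem_ball_self hS0)) (by fun_prop)
  rw [norm_zero] at hpeak
  obtain ⟨n, hn⟩ :=
    (hpeak.eventually (gt_mem_nhds (show (0 : ℝ) < ε / (M + 1) by positivity))).exists
  set I : ℝ := ∫ u in A, c u ^ n with hI
  have hcn : IntegrableOn (fun u => c u ^ n) A :=
    (by fun_prop : Continuous _).continuousOn.integrableOn_compact hAc
  have hI0 : 0 < I := by
    rw [hI, setIntegral_pos_iff_support_of_nonneg_ae ?_ hcn]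
    · refine lt_of_lt_of_le (Metric.measure_ball_pos volume (0 : ℂ) hS0) (measure_mono ?_)
      intro u hu
      have h1 : ‖u‖ < S := mem_ball_zero_iff.1 hu
      have h2 : ‖u‖ ^ 2 / S ^ 2 < 1 := (div_lt_one (by positivity)).2 (by gcongr)
      refine ⟨?_, Metric.ball_subset_closedBall hu⟩
      have : c u ≠ 0 := by simp only [c]; linarith
      exact pow_ne_zero _ this
    · filter_upwards [ae_restrict_mem measurableSet_closedBall] with u hu
      exact pow_nonneg (hc0 u hu) n
  let q : ℂ → ℂ := fun u => ((I⁻¹ * c u ^ n : ℝ) : ℂ)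
  have hqc : Continuous q := by fun_prop
  have hq : q ∈ polySpan := by
    have h1 : q = ∑ k ∈ Finset.range (n + 1),
        ((I : ℂ)⁻¹ * (-(S : ℂ) ^ 2)⁻¹ ^ k * n.choose k) • monom k k := by
      ext u
      simp only [q, c, Finset.sum_apply, Pi.smul_apply, smul_eq_mul, monom_self]
      push_cast
      rw [sub_eq_neg_add, add_pow, Finset.mul_sum]
      refine Finset.sum_congr rfl fun k _ => ?_
      rw [show -((‖u‖ : ℂ) ^ 2 / (S : ℂ) ^ 2) = (-(S : ℂ) ^ 2)⁻¹ * (‖u‖ : ℂ) ^ 2 by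
        rw [inv_neg]; ring, mul_pow, one_pow, pow_mul]
      ring
    rw [h1]
    exact sum_mem fun k _ => polySpan.smul_mem _ (monom_mem k k)
  refine ⟨_, convolution_mem hF.continuous hFc hq, ?_⟩
  have hq1 : ∫ u in A, q u = 1 := by
    simp only [q]
    rw [integral_complex_ofReal, integral_const_mul, ← hI, inv_mul_cancel₀ hI0.ne',
      Complex.ofReal_one]
  have hint : ∀ z, IntegrableOn (fun u => q u * (F z - F (z - u))) A := fun z =>
    (hqc.mul (continuous_const.sub (hF.continuous.comp
      (continuous_const.sub continuous_id)))).continuousOn.integrableOn_compact hAc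
  have hrep : ∀ z ∈ Metric.closedBall (0 : ℂ) 1, F z - ∫ w, F w * q (z - w) =
      ∫ u in A, q u * (F z - F (z - u)) := by
    intro z hz
    -- `F (z - u)` vanishes for `u ∉ A`, since `‖z‖ ≤ 1` and `S = R + 1`
    have h1 : ∫ w, F w * q (z - w) = ∫ u in A, q u * F (z - u) := by
      rw [← integral_sub_left_eq_self (fun w => F w * q (z - w)) volume z]
      rw [setIntegral_eq_integral_of_forall_compl_eq_zero]
      · simp [mul_comm]
      · intro u hu
        by_contra h
        have h2 := hR _ (right_ne_zero_of_mul h)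
        apply hu
        rw [hA, mem_closedBall_zero_iff]
        have h3 : ‖z‖ ≤ 1 := mem_closedBall_zero_iff.1 hz
        calc ‖u‖ = ‖z - (z - u)‖ := by rw [sub_sub_cancel]
          _ ≤ ‖z‖ + ‖z - u‖ := norm_sub_le _ _
          _ ≤ S := by linarith
    have h2 : F z = ∫ u in A, q u * F z := by
      rw [integral_mul_const, hq1, one_mul]
    rw [h1]
    conv_lhs => rw [h2]
    rw [← integral_sub]
    · simp only [mul_sub]
    · exact (hqc.mul continuous_const).continuousOn.integrableOn_compact hAc
    · exact (hqc.mul (hF.continuous.comp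
        (continuous_const.sub continuous_id))).continuousOn.integrableOn_compact hAc
  refine LipschitzOnWith.of_dist_le_mul fun z hz z' hz' => ?_
  rw [dist_eq_norm, dist_eq_norm]
  simp only [hrep z hz, hrep z' hz']
  rw [← integral_sub (hint z) (hint z')]
  have hbd : ∀ u ∈ A, ‖q u * (F z - F (z - u)) - q u * (F z' - F (z' - u))‖ ≤
      I⁻¹ * (c u ^ n * ‖u‖) * (M * ‖z - z'‖) := by
    intro u hu
    have h1 : 0 ≤ I⁻¹ * c u ^ n := mul_nonneg (by positivity) (pow_nonneg (hc0 u hu) n)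
    rw [← mul_sub, norm_mul, Complex.norm_real, Real.norm_of_nonneg h1]
    calc _ ≤ I⁻¹ * c u ^ n * (M * ‖u‖ * ‖z - z'‖) := by gcongr; exact hM u z z'
      _ = _ := by ring
  calc ‖∫ u in A, (q u * (F z - F (z - u)) - q u * (F z' - F (z' - u)))‖
      ≤ ∫ u in A, I⁻¹ * (c u ^ n * ‖u‖) * (M * ‖z - z'‖) := by
        refine norm_integral_le_of_norm_le ?_ ?_
        · exact (by fun_prop : Continuous fun u : ℂ =>
            I⁻¹ * (c u ^ n * ‖u‖) * (M * ‖z - z'‖)).continuousOn.integrableOn_compact hAc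
        · filter_upwards [ae_restrict_mem measurableSet_closedBall] with u hu using hbd u hu
    _ = (I⁻¹ * ∫ u in A, c u ^ n * ‖u‖) * M * ‖z - z'‖ := by
        rw [integral_mul_const, integral_const_mul]; ring
    _ ≤ (ε / (M + 1)) * (M + 1) * ‖z - z'‖ := by
        gcongr
        · exact hn.le
        · linarith
    _ = ε * ‖z - z'‖ := by rw [div_mul_cancel₀ _ (by positivity)]

/-- Polynomials in `z` and `conj z` approximate `C²` functions on the closed disk in the Lipschitz
seminorm. -/
theorem exists_poly_approx {f : ℂ → ℂ} (hf : ContDiffOn ℝ 2 f (Metric.closedBall 0 1)) {ε : ℝ≥0}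
    (hε : 0 < ε) :
    ∃ p ∈ polySpan, LipschitzOnWith ε (fun z => f z - p z) (Metric.closedBall 0 1) := by
  obtain ⟨F, hF, hFc, hfF⟩ := exists_contDiff_approx hf (half_pos hε)
  obtain ⟨p, hp, hFp⟩ := exists_poly_approx_of_hasCompactSupport hF hFc (half_pos hε)
  refine ⟨p, hp, ?_⟩
  have h := hfF.add hFp
  rw [add_halves] at h
  simpa using h

end Approximation

/-! ### The trace formula for spaces spanned by powers of a coordinate -/

section TraceFormula

open scoped ComplexConjugate NNReal

-- `α` lives in the lowest universe so that the bases indexed by `ℕ` are among those in `HasTrace`.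
variable {α : Type} [MeasurableSpace α] {μ : Measure α}
  {K : Submodule ℂ (Lp ℂ 2 μ)} [CompleteSpace K] {φ : α → ℂ} {u : ℕ → K}

/-- The trace formula for the symbols `f ∘ φ` and `g ∘ φ`, with the trace computed in the basis of
normalized monomials. -/
def TraceFormula (μ : Measure α) (K : Submodule ℂ (Lp ℂ 2 μ)) [CompleteSpace K] (φ : α → ℂ)
    (u : ℕ → K) (f g : ℂ → ℂ) : Prop :=
  ∀ (hf : MemLp (fun x => f (φ x)) ∞ μ) (hg : MemLp (fun x => g (φ x)) ∞ μ),
    HasSum (fun n => ⟪IsDiskModel.unit u n, ⁅compression μ K _ hf, compression μ K _ hg⁆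
      (IsDiskModel.unit u n)⟫_ℂ) (wedgeIntegral f g)

theorem TraceFormula.symm {f g : ℂ → ℂ} (h : TraceFormula μ K φ u f g) :
    TraceFormula μ K φ u g f := by
  intro hg hf
  rw [wedgeIntegral_swap]
  simpa only [← IsDiskModel.inner_lie_swap] using (h hf hg).neg

theorem inner_lie_add {φ₁ φ₂ : α → ℂ} (h₁ : MemLp φ₁ ∞ μ) (h₂ : MemLp φ₂ ∞ μ)
    (h : MemLp (fun x => φ₁ x + φ₂ x) ∞ μ) (T : K →L[ℂ] K) (x y : K) :
    ⟪x, ⁅compression μ K _ h, T⁆ y⟫_ℂ =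
      ⟪x, ⁅compression μ K _ h₁, T⁆ y⟫_ℂ + ⟪x, ⁅compression μ K _ h₂, T⁆ y⟫_ℂ := by
  have e : compression μ K _ h = compression μ K _ h₁ + compression μ K _ h₂ := by
    simp only [compression, mulOp_add h₁ h₂ h, ContinuousLinearMap.add_comp,
      ContinuousLinearMap.comp_add]
  refine (congrArg (fun v => ⟪x, v⟫_ℂ) ?_).trans (inner_add_right x _ _)
  rw [e]
  simp only [Ring.lie_def, sub_apply, mul_apply_eq_comp, add_apply, map_add]
  abel

theorem inner_lie_sub {φ₁ φ₂ : α → ℂ} (h₁ : MemLp φ₁ ∞ μ) (h₂ : MemLp φ₂ ∞ μ)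
    (h : MemLp (fun x => φ₁ x - φ₂ x) ∞ μ) (T : K →L[ℂ] K) (x y : K) :
    ⟪x, ⁅compression μ K _ h, T⁆ y⟫_ℂ =
      ⟪x, ⁅compression μ K _ h₁, T⁆ y⟫_ℂ - ⟪x, ⁅compression μ K _ h₂, T⁆ y⟫_ℂ := by
  have e : compression μ K _ h = compression μ K _ h₁ - compression μ K _ h₂ := by
    simp only [compression, mulOp_sub h₁ h₂ h, ContinuousLinearMap.sub_comp,
      ContinuousLinearMap.comp_sub]
  refine (congrArg (fun v => ⟪x, v⟫_ℂ) ?_).trans (inner_sub_right x _ _)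
  rw [e]
  simp only [Ring.lie_def, sub_apply, mul_apply_eq_comp, map_sub]
  abel

theorem inner_lie_smul {ψ : α → ℂ} (c : ℂ) (hψ : MemLp ψ ∞ μ) (h : MemLp (fun x => c * ψ x) ∞ μ)
    (T : K →L[ℂ] K) (x y : K) :
    ⟪x, ⁅compression μ K _ h, T⁆ y⟫_ℂ = c * ⟪x, ⁅compression μ K _ hψ, T⁆ y⟫_ℂ := by
  have e : compression μ K _ h = c • compression μ K _ hψ := by
    simp only [compression, mulOp_smul c hψ h, ContinuousLinearMap.smul_comp,
      ContinuousLinearMap.comp_smul]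
  rw [e, ← inner_smul_right_subspace]
  simp only [Ring.lie_def, sub_apply, mul_apply_eq_comp, smul_apply, map_smul, smul_sub]

theorem IsDiskModel.hasSum_of_hasTrace (hu : IsDiskModel μ K φ u) {T : K →L[ℂ] K} {t : ℂ}
    (h : HasTrace T t) :
    HasSum (fun n => ⟪IsDiskModel.unit u n, T (IsDiskModel.unit u n)⟫_ℂ) t := by
  simpa only [hu.coe_basis] using h.2 ℕ hu.basis

theorem traceFormula_monom [SFinite μ] (hu : IsDiskModel μ K φ u) (a b c d : ℕ) :
    TraceFormula μ K φ u (monom a b) (monom c d) := by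
  intro h h'
  obtain ⟨L, hL⟩ := exists_lipschitzOnWith (contDiff_monom a b).contDiffOn
  obtain ⟨M, hM⟩ := exists_lipschitzOnWith (contDiff_monom c d).contDiffOn
  obtain ⟨t, -, ht⟩ := hu.exists_hasTrace hL hM h h'
  have ht' := hu.hasSum_of_hasTrace ht
  rwa [hu.trace_monom h h' ht', ← wedgeIntegral_monom] at ht'

theorem TraceFormula.of_mem_left (hu : IsDiskModel μ K φ u) {p g : ℂ → ℂ} (hp : p ∈ polySpan)
    (hg : ContDiffOn ℝ 1 g (Metric.closedBall 0 1))
    (h : ∀ a b, TraceFormula μ K φ u (monom a b) g) : TraceFormula μ K φ u p g := by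
  have smooth : ∀ {p : ℂ → ℂ}, p ∈ polySpan → ContDiffOn ℝ 1 p (Metric.closedBall 0 1) :=
    fun hp => (contDiff_of_mem hp).contDiffOn
  induction hp using Submodule.span_induction with
  | mem p hp => obtain ⟨x, rfl⟩ := hp; exact h _ _
  | zero =>
    intro h0 hg'
    have m := hu.memLp (contDiff_monom 0 0 (n := 0)).continuous.continuousOn
    have e : (0 : ℂ → ℂ) = (0 : ℂ) • monom 0 0 := (zero_smul _ _).symm
    simp only [e] at h0 ⊢
    rw [wedgeIntegral_smul 0 (contDiff_monom 0 0).contDiffOn]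
    convert! (h 0 0 m hg').mul_left 0 using 1
    ext n
    exact inner_lie_smul 0 m h0 _ _ _
  | add p q hp hq hp' hq' =>
    intro hpq hg'
    have m1 := hu.memLp (smooth hp).continuousOn
    have m2 := hu.memLp (smooth hq).continuousOn
    rw [wedgeIntegral_add (smooth hp) (smooth hq) hg]
    convert! (hp' m1 hg').add (hq' m2 hg') using 1
    ext n
    exact inner_lie_add m1 m2 hpq _ _ _
  | smul c p hp hp' =>
    intro hcp hg'
    have m1 := hu.memLp (smooth hp).continuousOn
    rw [wedgeIntegral_smul c (smooth hp)]
    convert! (hp' m1 hg').mul_left c using 1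
    ext n
    exact inner_lie_smul c m1 hcp _ _ _

/-- Both sides of the trace formula are continuous in the Lipschitz seminorm, so that it extends
from polynomials to `C²` functions. -/
theorem TraceFormula.of_approx [SFinite μ] (hu : IsDiskModel μ K φ u) {f g : ℂ → ℂ}
    (hf : ContDiffOn ℝ 2 f (Metric.closedBall 0 1)) (hg : ContDiffOn ℝ 1 g (Metric.closedBall 0 1))
    (h : ∀ p ∈ polySpan, TraceFormula μ K φ u p g) : TraceFormula μ K φ u f g := by
  intro hf' hg'
  have hf1 : ContDiffOn ℝ 1 f (Metric.closedBall 0 1) := hf.of_le (by norm_num)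
  obtain ⟨L, hL⟩ := exists_lipschitzOnWith hf1
  obtain ⟨M, hM⟩ := exists_lipschitzOnWith hg
  obtain ⟨t, -, ht⟩ := hu.exists_hasTrace hL hM hf' hg'
  have ht := hu.hasSum_of_hasTrace ht
  suffices t = wedgeIntegral f g by rwa [← this]
  refine eq_of_norm_sub_le_zero (le_of_forall_pos_le_add fun ε hε => ?_)
  rw [zero_add]
  lift ε to ℝ≥0 using hε.le
  obtain ⟨p, hp, hfp⟩ := exists_poly_approx hf (ε := ε / (3 * (M + 1)))
    (div_pos (by exact_mod_cast hε) (by positivity))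
  have hp1 : ContDiffOn ℝ 1 p (Metric.closedBall 0 1) := (contDiff_of_mem hp).contDiffOn
  have hd1 : ContDiffOn ℝ 1 (fun z => f z - p z) (Metric.closedBall 0 1) := hf1.sub hp1
  have mp := hu.memLp hp1.continuousOn
  have md := hu.memLp hd1.continuousOn
  obtain ⟨t', ht'b, ht'⟩ := hu.exists_hasTrace hfp hM md hg'
  have e1 : t' = t - wedgeIntegral p g := by
    refine (hu.hasSum_of_hasTrace ht').unique ?_
    convert! ht.sub (h p hp mp hg') using 1
    ext n
    exact inner_lie_sub hf' mp md _ _ _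
  have e2 : wedgeIntegral f g = wedgeIntegral p g + wedgeIntegral (fun z => f z - p z) g := by
    rw [← wedgeIntegral_add hp1 hd1 hg]
    congr 1
    ext z
    simp
  have e3 := norm_wedgeIntegral_le hfp hM
  have e4 : t - wedgeIntegral f g = t' - wedgeIntegral (fun z => f z - p z) g := by
    rw [e1, e2]
    ring
  rw [e4]
  have e5 : ((ε / (3 * (M + 1)) : ℝ≥0) : ℝ) * (3 * (M + 1)) = ε := by
    push_cast
    exact div_mul_cancel₀ _ (by positivity)
  have e6 : (0 : ℝ) ≤ ((ε / (3 * (M + 1)) : ℝ≥0) : ℝ) := NNReal.coe_nonneg _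
  calc _ ≤ 2 * (((ε / (3 * (M + 1)) : ℝ≥0) : ℝ) * M) + ((ε / (3 * (M + 1)) : ℝ≥0) : ℝ) * M :=
        (norm_sub_le _ _).trans (add_le_add ht'b e3)
    _ ≤ ε := by linarith

/-- The trace formula in a disk model: first one symbol is passed from polynomials to `C²`
functions, then, using antisymmetry, the other one. -/
theorem IsDiskModel.hasTrace [SFinite μ] (hu : IsDiskModel μ K φ u) {f g : ℂ → ℂ}
    (hf : ContDiffOn ℝ 2 f (Metric.closedBall 0 1)) (hg : ContDiffOn ℝ 2 g (Metric.closedBall 0 1))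
    (hf' : MemLp (fun x => f (φ x)) ∞ μ) (hg' : MemLp (fun x => g (φ x)) ∞ μ) :
    HasTrace ⁅compression μ K _ hf', compression μ K _ hg'⁆ (wedgeIntegral f g) := by
  have hf1 : ContDiffOn ℝ 1 f (Metric.closedBall 0 1) := hf.of_le (by norm_num)
  have hg1 : ContDiffOn ℝ 1 g (Metric.closedBall 0 1) := hg.of_le (by norm_num)
  have hp1 : ∀ {p : ℂ → ℂ}, p ∈ polySpan → ContDiffOn ℝ 1 p (Metric.closedBall 0 1) :=
    fun hp => (contDiff_of_mem hp).contDiffOn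
  have hpq : ∀ p ∈ polySpan, ∀ q ∈ polySpan, TraceFormula μ K φ u p q := fun p hp q hq =>
    .of_mem_left hu hp (hp1 hq) fun a b => .symm <|
      .of_mem_left hu hq (hp1 (monom_mem a b)) fun c d => traceFormula_monom hu c d a b
  have hpg : ∀ p ∈ polySpan, TraceFormula μ K φ u p g := fun p hp =>
    .symm <| .of_approx hu hg (hp1 hp) fun q hq => hpq q hq p hp
  have hfg : TraceFormula μ K φ u f g := .of_approx hu hf hg1 hpg
  obtain ⟨L, hL⟩ := exists_lipschitzOnWith hf1
  obtain ⟨M, hM⟩ := exists_lipschitzOnWith hg1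
  obtain ⟨t, -, ht⟩ := hu.exists_hasTrace hL hM hf' hg'
  rwa [(hu.hasSum_of_hasTrace ht).unique (hfg hf' hg')] at ht

end TraceFormula

/-! ### The Hardy space -/

section Hardy

/-- The class of `z ^ n` in the Hardy space. -/
def hardyMonom (n : ℕ) : hardySpace :=
  ⟨fourierLp 2 (n : ℤ), Submodule.le_topologicalClosure _ (Submodule.subset_span ⟨n, rfl⟩)⟩

/-- The Hardy space is a disk model whose monomials all have norm `1`. -/
theorem isDiskModel_hardy : IsDiskModel AddCircle.haarAddCircle hardySpace
    (fun θ : AddCircle (1 : ℝ) => (AddCircle.toCircle θ : ℂ)) hardyMonom := by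
  have hon : Orthonormal ℂ (fun n : ℤ => fourierLp (T := (1 : ℝ)) 2 n) := orthonormal_fourier
  have hnorm : ∀ n, ‖hardyMonom n‖ = 1 := fun n => hon.1 n
  refine ⟨?_, ?_, fun n => ?_, fun n h => ?_, fun i j hij => ?_, fun h hh => ?_, ?_⟩
  · exact (continuous_subtype_val.comp AddCircle.continuous_toCircle).measurable
  · exact Eventually.of_forall fun θ => mem_closedBall_zero_iff.2 (Circle.norm_coe _).le
  · filter_upwards [coeFn_fourierLp (T := (1 : ℝ)) 2 (n : ℤ)] with θ hθ
    refine hθ.trans ?_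
    rw [fourier_apply, AddCircle.toCircle_zsmul, zpow_natCast, Circle.coe_pow]
  · have := hnorm n
    rw [h, norm_zero] at this
    exact zero_ne_one this
  · exact hon.2 (by exact_mod_cast hij)
  · have horth : ∀ x : Lp ℂ 2 (AddCircle.haarAddCircle (T := (1 : ℝ))),
        (∀ n : ℕ, ⟪fourierLp 2 (n : ℤ), x⟫_ℂ = 0) → x ∈ hardySpaceᗮ := by
      intro x hx
      rw [hardySpace, Submodule.orthogonal_closure, Submodule.mem_orthogonal]
      intro v hv
      induction hv using Submodule.span_induction with
      | mem v hv => obtain ⟨n, rfl⟩ := hv; exact hx n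
      | zero => exact inner_zero_left _
      | add v w _ _ hv hw => rw [inner_add_left, hv, hw, add_zero]
      | smul c v _ hv => rw [inner_smul_left, hv, mul_zero]
    have h1 := horth h hh
    have h2 := Submodule.inner_right_of_mem_orthogonal h.2 h1
    exact Subtype.ext (inner_self_eq_zero.1 h2)
  · simp [hnorm]

end Hardy

/-! ### The weighted Bergman spaces -/

section Bergman

open scoped ComplexConjugate

/-- Consecutive terms of a logarithmically convex bounded sequence which does not decay
exponentially have asymptotic ratio `1`. -/
theorem tendsto_ratio_one {m : ℕ → ℝ} (hpos : ∀ n, 0 < m n) (hle : ∀ n, m (n + 1) ≤ m n)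
    (hconv : ∀ n, m (n + 1) ^ 2 ≤ m n * m (n + 2))
    (hlow : ∀ s, 0 ≤ s → s < 1 → ∃ c, 0 < c ∧ ∀ n, c * s ^ n ≤ m n) :
    Tendsto (fun n => m (n + 1) / m n) atTop (𝓝 1) := by
  set ρ : ℕ → ℝ := fun n => m (n + 1) / m n with hρ
  have hmono : Monotone ρ := monotone_nat_of_le_succ fun n => by
    rw [hρ, div_le_div_iff₀ (hpos _) (hpos _)]
    linarith [hconv n, sq (m (n + 1)), mul_comm (m n) (m (n + 2))]
  have hρ1 : ∀ n, ρ n ≤ 1 := fun n => (div_le_one (hpos n)).2 (hle n)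
  have hbdd : BddAbove (Set.range ρ) := ⟨1, by rintro _ ⟨n, rfl⟩; exact hρ1 n⟩
  have hlim := tendsto_atTop_ciSup hmono hbdd
  set L := ⨆ n, ρ n with hL
  have hρL : ∀ n, ρ n ≤ L := le_ciSup hbdd
  have hL0 : 0 < L := (div_pos (hpos 1) (hpos 0)).trans_le (hρL 0)
  suffices L = 1 by rwa [this] at hlim
  refine le_antisymm (ciSup_le hρ1) (not_lt.1 fun hL1 => ?_)
  have hup : ∀ n, m n ≤ m 0 * L ^ n := by
    intro n
    induction n with
    | zero => simp
    | succ n ih =>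
      have h1 : m (n + 1) = ρ n * m n := (div_mul_cancel₀ _ (hpos n).ne').symm
      rw [h1, pow_succ, ← mul_assoc, mul_comm]
      exact mul_le_mul ih (hρL n) (div_pos (hpos _) (hpos _)).le
        (mul_nonneg (hpos 0).le (by positivity))
  -- any `s` strictly between `L` and `1` contradicts the lower bound
  obtain ⟨s, hs1, hs2⟩ := exists_between hL1
  have hs0 : 0 < s := hL0.trans hs1
  obtain ⟨c, hc, hcm⟩ := hlow s hs0.le hs2
  have h2 : Tendsto (fun n => m 0 * (L / s) ^ n) atTop (𝓝 (m 0 * 0)) :=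
    (tendsto_pow_atTop_nhds_zero_of_lt_one (by positivity)
      ((div_lt_one hs0).2 hs1)).const_mul _
  rw [mul_zero] at h2
  refine absurd (ge_of_tendsto' h2 fun n => ?_) (not_le.2 hc)
  rw [div_pow, ← mul_div_assoc, le_div_iff₀ (by positivity)]
  exact (hcm n).trans (hup n)

variable {t : ℝ}

/-- In polar coordinates the mass is comparable with `∫ (1 - r) ^ min t 0`, finite for `t > -1`. -/
theorem isFiniteMeasure_bergmanMeasure (ht : -1 < t) : IsFiniteMeasure (bergmanMeasure t) := by
  refine isFiniteMeasure_withDensity_ofReal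
    (f := fun z : ℂ => (t + 1) / Real.pi * (1 - ‖z‖ ^ 2) ^ t) ?_
  refine Integrable.hasFiniteIntegral ?_
  refine (integrableOn_fun_norm_addHaar volume
    (f := fun r : ℝ => (t + 1) / Real.pi * (1 - r ^ 2) ^ t)).2 ?_
  rw [Complex.finrank_real_complex]
  have h1 : IntegrableOn (fun r : ℝ => (1 - r) ^ (min t 0)) (Set.Ioo 0 1) := by
    have h2 := (intervalIntegral.intervalIntegrable_rpow' (a := 1) (b := 0) (r := min t 0)
      (lt_min ht (by norm_num))).comp_sub_left 1
    simp only [sub_self, sub_zero] at h2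
    exact ((intervalIntegrable_iff_integrableOn_Ioc_of_le zero_le_one).1 h2).mono_set
      Set.Ioo_subset_Ioc_self
  refine (h1.const_mul ((t + 1) / Real.pi)).mono' (by fun_prop) ?_
  filter_upwards [ae_restrict_mem measurableSet_Ioo] with r hr
  have hr0 := hr.1
  have hr1 := hr.2
  have h3 : 0 < 1 - r ^ 2 := by nlinarith
  have h4 : 1 - r ≤ 1 - r ^ 2 := by nlinarith
  have h5 : (1 - r ^ 2) ^ t ≤ (1 - r) ^ (min t 0) := by
    calc (1 - r ^ 2) ^ t ≤ (1 - r ^ 2) ^ (min t 0) :=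
          Real.rpow_le_rpow_of_exponent_ge h3 (by nlinarith) (min_le_left _ _)
      _ ≤ (1 - r) ^ (min t 0) :=
          Real.rpow_le_rpow_of_nonpos (by linarith) h4 (min_le_right _ _)
  have h6 : 0 ≤ (t + 1) / Real.pi := div_nonneg (by linarith) Real.pi_pos.le
  have h7 : 0 ≤ (1 - r ^ 2) ^ t := by positivity
  rw [smul_eq_mul, pow_one, Real.norm_of_nonneg (by positivity)]
  calc r * ((t + 1) / Real.pi * (1 - r ^ 2) ^ t) ≤ 1 * ((t + 1) / Real.pi * (1 - r ^ 2) ^ t) := by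
        gcongr
    _ ≤ _ := by rw [one_mul]; gcongr

theorem ae_mem_ball : ∀ᵐ z ∂(bergmanMeasure t), z ∈ Metric.ball (0 : ℂ) 1 :=
  (withDensity_absolutelyContinuous _ _).ae_le (ae_restrict_mem Metric.isOpen_ball.measurableSet)

theorem bergmanMeasure_pos (ht : -1 < t) {U : Set ℂ} (hU : IsOpen U) (hne : U.Nonempty)
    (hsub : U ⊆ Metric.ball 0 1) : bergmanMeasure t U ≠ 0 := by
  rw [bergmanMeasure, Ne, withDensity_apply_eq_zero (by fun_prop), Measure.restrict_apply']
  swap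
  · exact Metric.isOpen_ball.measurableSet
  refine (lt_of_lt_of_le (hU.measure_pos volume hne) (measure_mono fun z hz => ?_)).ne'
  refine ⟨⟨?_, hz⟩, hsub hz⟩
  have h1 : ‖z‖ < 1 := mem_ball_zero_iff.1 (hsub hz)
  have h2 : 0 < 1 - ‖z‖ ^ 2 := by nlinarith [norm_nonneg z]
  have h3 : 0 < t + 1 := by linarith
  have h4 := Real.pi_pos
  exact (ENNReal.ofReal_pos.2 (by positivity)).ne'

/-- Integrals against `λ_t` as integrals over the plane with a radial weight. -/
theorem integral_bergmanMeasure (ht : -1 < t) (G : ℂ → ℂ) : ∫ z, G z ∂(bergmanMeasure t) =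
    ∫ z, (Set.Iio (1 : ℝ)).indicator (fun r => (((t + 1) / Real.pi * (1 - r ^ 2) ^ t : ℝ) : ℂ)) ‖z‖
      * G z := by
  rw [bergmanMeasure, integral_withDensity_eq_integral_toReal_smul (by fun_prop)
    (Eventually.of_forall fun _ => ENNReal.ofReal_lt_top),
    ← integral_indicator Metric.isOpen_ball.measurableSet]
  refine integral_congr_ae (Eventually.of_forall fun z => ?_)
  by_cases hz : ‖z‖ < 1
  · have h2 : 0 < 1 - ‖z‖ ^ 2 := by nlinarith [norm_nonneg z]
    have h3 : 0 < t + 1 := by linarith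
    have h4 := Real.pi_pos
    simp only [Set.indicator, mem_ball_zero_iff, hz, if_true, Set.mem_Iio]
    rw [ENNReal.toReal_ofReal (by positivity), Complex.real_smul]
  · simp [Set.indicator, hz]

theorem setIntegral_bergman_monom (ht : -1 < t) {a b : ℕ} (hab : a ≠ b) (s : ℝ) :
    ∫ z in Metric.ball 0 s, monom a b z ∂(bergmanMeasure t) = 0 := by
  rw [← integral_indicator Metric.isOpen_ball.measurableSet, integral_bergmanMeasure ht]
  refine Eq.trans ?_ (integral_radial_mul_monom ((Set.Iio s).indicator ((Set.Iio (1 : ℝ)).indicator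
    (fun r => (((t + 1) / Real.pi * (1 - r ^ 2) ^ t : ℝ) : ℂ)))) hab)
  refine integral_congr_ae (Eventually.of_forall fun z => ?_)
  by_cases hz : ‖z‖ < s <;> simp [Set.indicator, hz]

theorem memLp_two_bergman (ht : -1 < t) {f : ℂ → ℂ} (hf : Continuous f) :
    MemLp f 2 (bergmanMeasure t) :=
  have := isFiniteMeasure_bergmanMeasure ht
  (memLp_bergmanMeasure t hf.continuousOn).mono_exponent le_top

theorem integrable_bergman (ht : -1 < t) {f : ℂ → ℂ} (hf : Continuous f) :
    Integrable f (bergmanMeasure t) :=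
  have := isFiniteMeasure_bergmanMeasure ht
  (memLp_bergmanMeasure t hf.continuousOn).integrable le_top

/-- The class of `z ^ n` in the weighted Bergman space. -/
def bergmanMonom (ht : -1 < t) (n : ℕ) : bergmanSpace t :=
  ⟨(memLp_two_bergman ht (continuous_pow n)).toLp (fun z : ℂ => z ^ n), fun z => z ^ n,
    (differentiable_pow n).differentiableOn, MemLp.coeFn_toLp _⟩

theorem bergmanMonom_ae (ht : -1 < t) (n : ℕ) :
    (bergmanMonom ht n : Lp ℂ 2 (bergmanMeasure t)) =ᵐ[bergmanMeasure t] fun z => z ^ n :=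
  MemLp.coeFn_toLp (memLp_two_bergman ht (continuous_pow n))

theorem inner_bergmanMonom (ht : -1 < t) (i j : ℕ) :
    ⟪bergmanMonom ht i, bergmanMonom ht j⟫_ℂ = ∫ z, monom j i z ∂(bergmanMeasure t) := by
  rw [Submodule.coe_inner, inner_eq_integral]
  refine integral_congr_ae ?_
  filter_upwards [bergmanMonom_ae ht i, bergmanMonom_ae ht j] with z h1 h2
  rw [h1, h2, monom, map_pow, mul_comm]

theorem norm_bergmanMonom_sq (ht : -1 < t) (n : ℕ) :
    ‖bergmanMonom ht n‖ ^ 2 = ∫ z, ‖z‖ ^ (2 * n) ∂(bergmanMeasure t) := by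
  apply Complex.ofReal_injective
  rw [← inner_self_subspace, inner_bergmanMonom, ← integral_complex_ofReal]
  simp only [monom_self]

theorem bergmanMonom_ne_zero (ht : -1 < t) (n : ℕ) : bergmanMonom ht n ≠ 0 := by
  intro h
  have h1 : (bergmanMonom ht n : Lp ℂ 2 (bergmanMeasure t)) = 0 := by rw [h]; rfl
  have h2 : ∀ᵐ z ∂(bergmanMeasure t), z = 0 := by
    filter_upwards [bergmanMonom_ae ht n, (Lp.eq_zero_iff_ae_eq_zero.1 h1)] with z h3 h4
    exact eq_zero_of_pow_eq_zero (h3.symm.trans h4)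
  refine bergmanMeasure_pos ht (U := Metric.ball 0 1 ∩ {0}ᶜ)
    (Metric.isOpen_ball.inter isOpen_compl_singleton) ⟨1 / 2, by norm_num, by norm_num⟩
    Set.inter_subset_left (measure_mono_null Set.inter_subset_right h2)

/-- The moments of the radial measure `λ_t` are logarithmically convex, and they do not decay
exponentially because `λ_t` charges every annulus near the unit circle. -/
theorem tendsto_ratio_bergman (ht : -1 < t) : Tendsto
    (fun n => ‖bergmanMonom ht (n + 1)‖ ^ 2 / ‖bergmanMonom ht n‖ ^ 2) atTop (𝓝 1) := by
  have := isFiniteMeasure_bergmanMeasure ht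
  have hint : ∀ n, Integrable (fun z : ℂ => ‖z‖ ^ (2 * n)) (bergmanMeasure t) := fun n => by
    simpa using (integrable_bergman ht (continuous_pow (2 * n))).norm
  have hpos : ∀ n, 0 < ‖bergmanMonom ht n‖ ^ 2 := fun n =>
    pow_pos (norm_pos_iff.2 (bergmanMonom_ne_zero ht n)) 2
  refine tendsto_ratio_one (m := fun n => ‖bergmanMonom ht n‖ ^ 2) hpos ?_ ?_ ?_
  · intro n
    simp only [norm_bergmanMonom_sq]
    refine integral_mono_ae (hint _) (hint _) ?_
    filter_upwards [ae_mem_ball] with z hz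
    exact pow_le_pow_of_le_one (norm_nonneg _) (mem_ball_zero_iff.1 hz).le (by omega)
  · intro n
    -- integrate the square of `|z| ^ n (|z|² - ρ)` with `ρ` the ratio of consecutive moments
    set m : ℕ → ℝ := fun n => ‖bergmanMonom ht n‖ ^ 2 with hm
    change m (n + 1) ^ 2 ≤ m n * m (n + 2)
    set ρ : ℝ := m (n + 1) / m n with hρ
    have h1 : 0 ≤ ∫ z, (‖z‖ ^ (2 * (n + 2)) - 2 * ρ * ‖z‖ ^ (2 * (n + 1)) +
        ρ ^ 2 * ‖z‖ ^ (2 * n) : ℝ) ∂(bergmanMeasure t) := by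
      refine integral_nonneg fun z => ?_
      have : (‖z‖ ^ (2 * (n + 2)) - 2 * ρ * ‖z‖ ^ (2 * (n + 1)) + ρ ^ 2 * ‖z‖ ^ (2 * n) : ℝ) =
        (‖z‖ ^ n * (‖z‖ ^ 2 - ρ)) ^ 2 := by ring
      simp only [this]
      positivity
    replace h1 := h1.trans_eq (integral_add ((hint (n + 2)).sub ((hint (n + 1)).const_mul (2 * ρ)))
      ((hint n).const_mul (ρ ^ 2)))
    rw [integral_sub (hint _) ((hint _).const_mul _), integral_const_mul, integral_const_mul,
      ← norm_bergmanMonom_sq, ← norm_bergmanMonom_sq, ← norm_bergmanMonom_sq] at h1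
    change 0 ≤ m (n + 2) - 2 * ρ * m (n + 1) + ρ ^ 2 * m n at h1
    have h2 : ρ * m n = m (n + 1) := div_mul_cancel₀ _ (hpos n).ne'
    have h3 : 0 < m n := hpos n
    nlinarith [mul_nonneg h3.le h1]
  · intro s hs0 hs1
    set A : Set ℂ := {z | s ≤ ‖z‖ ^ 2} with hA
    have hAm : MeasurableSet A := measurableSet_le measurable_const (by fun_prop)
    refine ⟨(bergmanMeasure t).real A, ?_, fun n => ?_⟩
    · obtain ⟨r, hr1, hr2⟩ := exists_between hs1
      have hr0 : 0 ≤ r := hs0.trans hr1.le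
      have hnorm : ‖((√r : ℝ) : ℂ)‖ = √r := by
        rw [Complex.norm_real, Real.norm_of_nonneg (Real.sqrt_nonneg _)]
      have hopen : IsOpen {z : ℂ | s < ‖z‖ ^ 2} := isOpen_lt continuous_const (by fun_prop)
      have hmem : ((√r : ℝ) : ℂ) ∈ Metric.ball (0 : ℂ) 1 ∩ {z : ℂ | s < ‖z‖ ^ 2} := by
        refine ⟨?_, ?_⟩
        · rw [mem_ball_zero_iff, hnorm, Real.sqrt_lt' one_pos, one_pow]
          exact hr2
        · rw [Set.mem_ofPred_eq, hnorm, Real.sq_sqrt hr0]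
          exact hr1
      have h1 := bergmanMeasure_pos ht (Metric.isOpen_ball.inter hopen) ⟨_, hmem⟩
        Set.inter_subset_left
      have h2 : Metric.ball (0 : ℂ) 1 ∩ {z : ℂ | s < ‖z‖ ^ 2} ⊆ A := by
        intro z hz
        have h3 : s < ‖z‖ ^ 2 := hz.2
        exact h3.le
      exact ENNReal.toReal_pos (fun h => h1 (measure_mono_null h2 h)) (measure_ne_top _ _)
    · simp only [norm_bergmanMonom_sq]
      calc (bergmanMeasure t).real A * s ^ n = ∫ z in A, s ^ n ∂(bergmanMeasure t) := by
            rw [setIntegral_const, smul_eq_mul]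
        _ ≤ ∫ z in A, ‖z‖ ^ (2 * n) ∂(bergmanMeasure t) := by
            refine setIntegral_mono_on (integrable_const _).integrableOn (hint n).integrableOn hAm
              fun z hz => ?_
            rw [pow_mul]
            exact pow_le_pow_left₀ hs0 hz n
        _ ≤ ∫ z, ‖z‖ ^ (2 * n) ∂(bergmanMeasure t) :=
            setIntegral_le_integral (hint n) (Eventually.of_forall fun z => by positivity)

/-- The Taylor coefficients of a holomorphic function can be computed by integrating over disks. -/
theorem setIntegral_conj_pow_mul (ht : -1 < t) {F : ℂ → ℂ}
    (hF : DifferentiableOn ℂ F (Metric.ball 0 1)) {s : ℝ} (hs0 : 0 ≤ s) (hs : s < 1) (n : ℕ) :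
    ∫ z in Metric.ball 0 s, conj z ^ n * F z ∂(bergmanMeasure t) =
      ((n.factorial : ℂ)⁻¹ * iteratedDeriv n F 0) *
        ∫ z in Metric.ball 0 s, monom n n z ∂(bergmanMeasure t) := by
  have := isFiniteMeasure_bergmanMeasure ht
  set a : ℕ → ℂ := fun k => (k.factorial : ℂ)⁻¹ * iteratedDeriv k F 0 with ha
  have hsum : ∀ z ∈ Metric.ball (0 : ℂ) 1, HasSum (fun k => a k * z ^ k) (F z) := by
    intro z hz
    have h := Complex.hasSum_taylorSeries_on_ball hF hz
    convert! h using 1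
    ext k
    simp only [sub_zero, smul_eq_mul, ha]
    ring
  have hs_mem : (s : ℂ) ∈ Metric.ball (0 : ℂ) 1 := by
    rw [mem_ball_zero_iff, Complex.norm_real, Real.norm_of_nonneg hs0]
    exact hs
  have hbd : Summable fun k => ‖a k‖ * s ^ k := by
    have h := (hsum s hs_mem).summable.norm
    simpa [abs_of_nonneg hs0] using h
  have hsub : Metric.ball (0 : ℂ) s ⊆ Metric.ball 0 1 := Metric.ball_subset_ball hs.le
  have key : HasSum (fun k => ∫ z in Metric.ball 0 s, a k * monom k n z ∂(bergmanMeasure t))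
      (∫ z in Metric.ball 0 s, conj z ^ n * F z ∂(bergmanMeasure t)) := by
    refine hasSum_integral_of_dominated_convergence (fun k _ => ‖a k‖ * s ^ k) (fun k => ?_)
      (fun k => ?_) (Eventually.of_forall fun _ => hbd) (integrable_const _) ?_
    · exact (continuous_const.mul (contDiff_monom k n (n := 0)).continuous).aestronglyMeasurable
    · filter_upwards [ae_restrict_mem Metric.isOpen_ball.measurableSet] with z hz
      have h1 : ‖z‖ < s := mem_ball_zero_iff.1 hz
      rw [monom, norm_mul (a k), norm_mul (z ^ k), norm_pow, norm_pow, RCLike.norm_conj]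
      gcongr
      calc ‖z‖ ^ k * ‖z‖ ^ n ≤ s ^ k * 1 := by
            gcongr
            exact pow_le_one₀ (norm_nonneg _) (h1.le.trans hs.le)
        _ = s ^ k := mul_one _
    · filter_upwards [ae_restrict_mem Metric.isOpen_ball.measurableSet] with z hz
      convert! (hsum z (hsub hz)).mul_left (conj z ^ n) using 1
      ext k
      rw [monom]
      ring
  have hsingle := hasSum_single (f := fun k => ∫ z in Metric.ball 0 s, a k * monom k n z
    ∂(bergmanMeasure t)) n fun k hk => by
      rw [integral_const_mul, setIntegral_bergman_monom ht hk, mul_zero]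
  rw [key.unique hsingle, integral_const_mul]

/-- Totality of the monomials: a holomorphic function in `L²(λ_t)` orthogonal to all of them has
vanishing Taylor coefficients. -/
theorem isDiskModel_bergman (ht : -1 < t) :
    IsDiskModel (bergmanMeasure t) (bergmanSpace t) (fun z => z) (bergmanMonom ht) := by
  have := isFiniteMeasure_bergmanMeasure ht
  refine ⟨measurable_id, ?_, bergmanMonom_ae ht, bergmanMonom_ne_zero ht, fun i j hij => ?_,
    fun h hh => ?_, tendsto_ratio_bergman ht⟩
  · filter_upwards [ae_mem_ball] with z hz using Metric.ball_subset_closedBall hz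
  · change ⟪bergmanMonom ht i, bergmanMonom ht j⟫_ℂ = 0
    rw [inner_bergmanMonom, ← setIntegral_bergman_monom ht hij.symm 1]
    rw [Measure.restrict_eq_self_of_ae_mem ae_mem_ball]
  · obtain ⟨F, hF, hhF⟩ := h.2
    -- exhaust the disk by smaller disks, on which the Taylor series converges uniformly
    let B (j : ℕ) : Set ℂ := Metric.ball 0 (1 - 1 / ((j : ℝ) + 1))
    have hBm : ∀ j, MeasurableSet (B j) := fun j => Metric.isOpen_ball.measurableSet
    have hBmono : Monotone B := fun i j hij => Metric.ball_subset_ball (by gcongr)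
    have hBU : ⋃ j, B j = Metric.ball (0 : ℂ) 1 := by
      ext z
      simp only [Set.mem_iUnion, B, mem_ball_zero_iff]
      constructor
      · rintro ⟨j, hj⟩
        have : 0 < 1 / ((j : ℝ) + 1) := by positivity
        linarith
      · intro hz
        obtain ⟨j, hj⟩ := exists_nat_one_div_lt (sub_pos.2 hz)
        exact ⟨j, by linarith⟩
    have hlim : ∀ {G : ℂ → ℂ}, Integrable G (bergmanMeasure t) →
        Tendsto (fun j => ∫ z in B j, G z ∂(bergmanMeasure t)) atTop
          (𝓝 (∫ z, G z ∂(bergmanMeasure t))) := by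
      intro G hG
      have h1 := tendsto_setIntegral_of_monotone hBm hBmono (f := G) (μ := bergmanMeasure t)
        hG.integrableOn
      rwa [hBU, Measure.restrict_eq_self_of_ae_mem ae_mem_ball] at h1
    have hcoef : ∀ n, (n.factorial : ℂ)⁻¹ * iteratedDeriv n F 0 = 0 := by
      intro n
      have hG : (fun z => conj ((bergmanMonom ht n : Lp ℂ 2 (bergmanMeasure t)) z) *
          (h : Lp ℂ 2 (bergmanMeasure t)) z) =ᵐ[bergmanMeasure t] fun z => conj z ^ n * F z := by
        filter_upwards [bergmanMonom_ae ht n, hhF] with z h1 h2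
        rw [h1, h2, map_pow]
      have h1 := hlim ((integrable_conj_mul _ _).congr hG)
      rw [← integral_congr_ae hG, ← inner_eq_integral] at h1
      have h2 : ⟪(bergmanMonom ht n : Lp ℂ 2 (bergmanMeasure t)),
          (h : Lp ℂ 2 (bergmanMeasure t))⟫_ℂ = 0 := hh n
      rw [h2] at h1
      have h3 := (hlim (integrable_bergman ht
        (contDiff_monom n n (n := 0)).continuous)).const_mul
          ((n.factorial : ℂ)⁻¹ * iteratedDeriv n F 0)
      rw [← inner_bergmanMonom ht, inner_self_subspace] at h3
      have h4 := tendsto_nhds_unique h3 (h1.congr fun j => ?_)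
      · refine (mul_eq_zero.1 h4).resolve_right ?_
        exact Complex.ofReal_ne_zero.2 <| pow_ne_zero 2
          (norm_ne_zero_iff.2 (bergmanMonom_ne_zero ht n))
      · refine setIntegral_conj_pow_mul ht hF ?_ ?_ n
        · rw [sub_nonneg]
          exact div_le_one_of_le₀ (by linarith [(Nat.cast_nonneg j : (0 : ℝ) ≤ j)]) (by positivity)
        · have : 0 < 1 / ((j : ℝ) + 1) := by positivity
          linarith
    apply Subtype.ext
    apply Lp.ext
    filter_upwards [hhF, ae_mem_ball, Lp.coeFn_zero ℂ 2 (bergmanMeasure t)] with z h1 h2 h3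
    rw [h1]
    refine Eq.trans ?_ h3.symm
    refine (Complex.hasSum_taylorSeries_on_ball hF h2).unique ?_
    convert! hasSum_zero with n
    have := hcoef n
    simp only [smul_eq_mul]
    linear_combination (z - 0) ^ n * this

end Bergman

end

end ToeplitzDisk

theorem corollary3p4 (f g : ℂ → ℂ)
    (hf : ContDiffOn ℝ 2 f (Metric.closedBall 0 1))
    (hg : ContDiffOn ℝ 2 g (Metric.closedBall 0 1)) :
    MeasureTheory.IntegrableOn (ToeplitzDisk.wedgeCoeff f g) (Metric.ball 0 1) ∧
    (∀ t : ℝ, -1 < t →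
      ToeplitzDisk.HasTrace
        ⁅ToeplitzDisk.bergmanToeplitz t f hf.continuousOn,
          ToeplitzDisk.bergmanToeplitz t g hg.continuousOn⁆
        (1 / (2 * Real.pi * Complex.I) *
          ∫ z in Metric.ball (0 : ℂ) 1, ToeplitzDisk.wedgeCoeff f g z)) ∧
    ToeplitzDisk.HasTrace
      ⁅ToeplitzDisk.hardyToeplitz f (hf.continuousOn.mono Metric.sphere_subset_closedBall),
        ToeplitzDisk.hardyToeplitz g (hg.continuousOn.mono Metric.sphere_subset_closedBall)⁆
      (1 / (2 * Real.pi * Complex.I) *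
        ∫ z in Metric.ball (0 : ℂ) 1, ToeplitzDisk.wedgeCoeff f g z) := by
  refine ⟨ToeplitzDisk.integrableOn_wedgeCoeff (hf.of_le (by norm_num)) (hg.of_le (by norm_num)),
    fun t ht => ?_, ?_⟩
  · have := ToeplitzDisk.isFiniteMeasure_bergmanMeasure ht
    exact (ToeplitzDisk.isDiskModel_bergman ht).hasTrace hf hg _ _
  · exact ToeplitzDisk.isDiskModel_hardy.hasTrace hf hg _ _
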